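/- For real $x,y,z$ let $$E(x,y,z)=\frac1{2\pi}\iint_{\mathbb R^2}\exp\{-i(x\xi+y\eta)\}\,\exp\{-iz(\xi^2+\eta^2)+i(\xi^3-3\xi\eta^2)\}\,d\xi\,d\eta$$ be the elliptic umbilic integral, understood as an improper double integral, that is, as the limit of the integrals over rectangles $[-a,b]\times[-c,d]$ when $a,b,c,d\to+\infty$ independently. For $w\in\mathbb C$ and $b_1,b_2\notin\{0,-1,-2,\dots\}$ let $${}_2F_2(a_1,a_2;b_1,b_2\mid w)=\sum_{n\ge0}\frac{(a_1)_n(a_2)_n}{(b_1)_n(b_2)_n}\,\frac{w^n}{n!},$$ where $(a)_n=a(a+1)\cdots(a+n-1)$. Then for every real $z$ the improper integrals defining $E(z^2,0,z)$ and $E(-z^2/3,0,z)$ converge, and $$E(z^2,0,z)=\frac{\sqrt\pi}{3}\,e^{5iz^3/27}\left\{\frac{1}{\Gamma(5/6)}\,{}_2F_2\!\left(\tfrac1{12},\tfrac7{12};\tfrac13,\tfrac23\,\Big|\,-\tfrac{32}{27}iz^3\right)-\frac{iz}{3\Gamma(7/6)}\,{}_2F_2\!\left(\tfrac5{12},\tfrac{11}{12};\tfrac23,\tfrac43\,\Big|\,-\tfrac{32}{27}iz^3\right)\right\},$$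 $$E\!\left(-\tfrac{z^2}{3},0,z\right)=\frac{\sqrt\pi}{3}\,e^{iz^3/27}\left\{\frac{1}{\Gamma(5/6)}\,{}_2F_2\!\left(\tfrac16,\tfrac12;\tfrac13,\tfrac23\,\Big|\,-\tfrac{8}{27}iz^3\right)-\frac{iz}{3\Gamma(7/6)}\,{}_2F_2\!\left(\tfrac12,\tfrac56;\tfrac23,\tfrac43\,\Big|\,-\tfrac{8}{27}iz^3\right)\right\}.$$ -/

import Mathlib

open Filter Topology MeasureTheory

/-- The integral over the rectangle `[p.1.1, p.2.1] × [p.1.2, p.2.2]` of the 2D Fourier transform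
of `f` at `(x, y)`, normalised by `1 / (2π)`. A rectangle is given by its lower left corner `p.1`
and its upper right corner `p.2`. -/
noncomputable def fourierTrunc (f : ℝ × ℝ → ℂ) (x y : ℝ) (p : (ℝ × ℝ) × (ℝ × ℝ)) : ℂ :=
  (1 / (2 * (Real.pi : ℂ))) *
    ∫ v in Set.Icc p.1 p.2, Complex.exp (-Complex.I * ((x : ℂ) * v.1 + (y : ℂ) * v.2)) * f v

/-- The 2D Fourier integral of `f` at `(x, y)` converges, as an improper double integral, to `w`:
the integrals over rectangles tend to `w` when the four sides go to infinity independently. -/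
def HasFourierTransformAt (f : ℝ × ℝ → ℂ) (x y : ℝ) (w : ℂ) : Prop :=
  Tendsto (fourierTrunc f x y) (atBot ×ˢ atTop) (𝓝 w)

/-- The 2D Fourier transform `(1 / (2π)) ∬ exp (-i (x ξ + y η)) f (ξ, η) dξ dη`, as an improper
double integral (a junk value if it does not converge). -/
noncomputable def fourierTransform2 (f : ℝ × ℝ → ℂ) (x y : ℝ) : ℂ :=
  limUnder (atBot ×ˢ atTop) (fourierTrunc f x y)

/-- The initial distribution `exp (-i z (ξ² + η²) + i (ξ³ - 3 ξ η²))`. -/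
noncomputable def umbilicDistribution (z : ℝ) (v : ℝ × ℝ) : ℂ :=
  Complex.exp (-Complex.I * z * ((v.1 : ℂ) ^ 2 + (v.2 : ℂ) ^ 2)
    + Complex.I * ((v.1 : ℂ) ^ 3 - 3 * (v.1 : ℂ) * (v.2 : ℂ) ^ 2))

/-- The elliptic umbilic canonical integral `E(x, y, z)`. -/
noncomputable def ellipticUmbilic (x y z : ℝ) : ℂ :=
  fourierTransform2 (umbilicDistribution z) x y

/-- The generalized hypergeometric function `₂F₂(a₁, a₂; b₁, b₂ | w)`, for `b₁, b₂` different from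
`0, -1, -2, …`, obtained from Mathlib's regularized one. -/
noncomputable def hypergeometric2F2 (a₁ a₂ b₁ b₂ w : ℂ) : ℂ :=
  Complex.Gamma b₁ * Complex.Gamma b₂ * Complex.regularizedHGFun {a₁, a₂} {b₁, b₂} w

/-- `₂F₂` is the sum of the everywhere convergent classical hypergeometric series. -/
theorem hasSum_hypergeometric2F2 (a₁ a₂ b₁ b₂ w : ℂ)
    (h₁ : ∀ k : ℕ, b₁ ≠ -k) (h₂ : ∀ k : ℕ, b₂ ≠ -k) :
    HasSum (fun n : ℕ => (ascPochhammer ℂ n).eval a₁ * (ascPochhammer ℂ n).eval a₂ /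
      ((ascPochhammer ℂ n).eval b₁ * (ascPochhammer ℂ n).eval b₂ * (n.factorial : ℂ)) * w ^ n)
      (hypergeometric2F2 a₁ a₂ b₁ b₂ w) := by
  have hr : (Complex.regularizedHGFunSeries {a₁, a₂} {b₁, b₂}).radius = ⊤ :=
    Complex.radius_regularizedHGFunSeries_eq_top (by simp)
  have hs := ((Complex.regularizedHGFunSeries {a₁, a₂} {b₁, b₂}).hasSum (x := w)
    (by rw [hr]; simp)).mul_left (Complex.Gamma b₁ * Complex.Gamma b₂)
  have g₁ : Complex.Gamma b₁ ≠ 0 := Complex.Gamma_ne_zero h₁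
  have g₂ : Complex.Gamma b₂ ≠ 0 := Complex.Gamma_ne_zero h₂
  refine hs.congr_fun fun n => ?_
  rw [← Complex.Gamma_add_nat_div_Gamma_eq b₁ h₁, ← Complex.Gamma_add_nat_div_Gamma_eq b₂ h₂]
  simp [Complex.regularizedHGFunCoeff]
  field_simp

/-!
After the shift `t = ξ + z / 3` the phase of `E(x, 0, z)` becomes, up to a constant,
`t ^ 3 + b * t ^ 2 + c * t - 3 * t * η ^ 2` with `b = -2 * z` and `c = z ^ 2 - x`. By evenness in
`η` and by complex conjugation (which turns `t` into `-t` and `b` into `-b`), the integral over a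
rectangle is a sum of four integrals over `[0, T] × [0, H]`.

Such a quadrant integral converges as `T` and `H` tend to infinity independently. If `T > 2 * H`,
the part with `2 * H < t` has no stationary point in `t`, and the first derivative test of
van der Corput bounds it by `3 / H` (`norm_quarterIntegral_sub_quarterIntegral_le`). If `T ≤ 2 * H`,
the substitution `t = y ^ 2` gives `2 ∫ exp (i P(y ^ 2)) conj (G(y * H)) dy` with `G` the Fresnel
integral, and replacing `G(y * H)` by `G(∞)` costs at most a constant times `H ^ (-1 / 4)`
(`norm_quarterIntegral_sub_le`). What remains is the integral of the entire function
`exp (i P(y ^ 2))`, whose path is rotated by `π / 12` (`tendsto_integral_rotate`), where the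
integrand decays like `exp (-r ^ 6)`. So `E(x, 0, z)` is a combination of two absolutely convergent
integrals `rayIntegral b c ω` with `ω ^ 3 = i`
(`hasFourierTransformAt_umbilicDistribution`).

For `x = z ^ 2` one has `c = 0`: expanding `exp (i b ω ^ 2 r ^ 4)` gives a series of Gamma values
(`hasSum_rayIntegral_zero_right`). For `x = -z ^ 2 / 3` one has `c = b ^ 2 / 3`, so that with
`b = -3 * a` the phase is `(t - a) ^ 3 + a ^ 3`: Taylor expansion in `a` gives the integrals of the
derivatives of `exp (i s ^ 3)` along the ray, and two integrations by parts give a recursion of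
step three for them (`derivMoment_add_three`). In both series the coefficients whose index is
`2` modulo `3` cancel between the two rays, and the two other residue classes are the two `₂F₂`
series.
-/

/-! ### Oscillatory integrals and rotation of rays -/

/-- The first derivative test of van der Corput: if the phase `φ` is convex and `φ' ≥ m > 0`, then
`∫ exp (i φ)` is bounded by `3 / m` on every interval. It is an integration by parts, the
remaining integrand being dominated by the derivative of `-1 / φ'`. -/
theorem norm_integral_cexp_mul_I_le {φ φ' φ'' : ℝ → ℝ} {a b m : ℝ} (hab : a ≤ b) (hm : 0 < m)
    (h₁ : ∀ t, HasDerivAt φ (φ' t) t) (h₂ : ∀ t, HasDerivAt φ' (φ'' t) t)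
    (hc : Continuous φ'') (hpos : ∀ t ∈ Set.Icc a b, 0 ≤ φ'' t)
    (hlow : ∀ t ∈ Set.Icc a b, m ≤ φ' t) :
    ‖∫ t in a..b, Complex.exp (φ t * Complex.I)‖ ≤ 3 / m := by
  have hφ : Continuous φ := continuous_iff_continuousAt.2 fun t => (h₁ t).continuousAt
  have hφ' : Continuous φ' := continuous_iff_continuousAt.2 fun t => (h₂ t).continuousAt
  have hu : Set.uIcc a b = Set.Icc a b := Set.uIcc_of_le hab
  have hpos' : ∀ t ∈ Set.uIcc a b, 0 < φ' t := fun t ht => hm.trans_le (hlow t (hu ▸ ht))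
  have hne : ∀ t ∈ Set.uIcc a b, (φ' t : ℂ) ≠ 0 := fun t ht => by
    exact_mod_cast (hpos' t ht).ne'
  have hcE : Continuous fun t : ℝ => Complex.exp (φ t * Complex.I) := by fun_prop
  have hcR : ContinuousOn (fun t : ℝ => φ'' t / φ' t ^ 2) (Set.uIcc a b) :=
    hc.continuousOn.div (hφ'.pow 2).continuousOn fun t ht => (pow_pos (hpos' t ht) 2).ne'
  have hcQ : ContinuousOn (fun t : ℝ => Complex.exp (φ t * Complex.I) *
      ((φ'' t / φ' t ^ 2 : ℝ) : ℂ) * (-Complex.I)) (Set.uIcc a b) :=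
    (hcE.continuousOn.mul (Complex.continuous_ofReal.comp_continuousOn hcR)).mul
      continuousOn_const
  have hiR : IntervalIntegrable (fun t : ℝ => φ'' t / φ' t ^ 2) volume a b :=
    hcR.intervalIntegrable
  have hiQ := hcQ.intervalIntegrable (μ := volume)
  have hd : ∀ t ∈ Set.uIcc a b, HasDerivAt
      (fun s : ℝ => Complex.exp (φ s * Complex.I) / (φ' s : ℂ) * (-Complex.I))
      (Complex.exp (φ t * Complex.I) - Complex.exp (φ t * Complex.I) *
      ((φ'' t / φ' t ^ 2 : ℝ) : ℂ) * (-Complex.I)) t := by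
    intro t ht
    have e := ((((h₁ t).ofReal_comp.mul_const Complex.I).cexp.div (h₂ t).ofReal_comp
      (hne t ht)).mul_const (-Complex.I))
    refine e.congr_deriv ?_
    have := hne t ht
    push_cast
    field_simp
    linear_combination (-(φ' t : ℂ) ^ 2) * Complex.I_sq
  have hF := intervalIntegral.integral_eq_sub_of_hasDerivAt hd
    ((hcE.intervalIntegrable a b).sub hiQ)
  rw [intervalIntegral.integral_sub (hcE.intervalIntegrable a b) hiQ, sub_eq_iff_eq_add] at hF
  have hdR : ∀ t ∈ Set.uIcc a b, HasDerivAt (fun s : ℝ => -(φ' s)⁻¹) (φ'' t / φ' t ^ 2) t := by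
    intro t ht
    exact ((h₂ t).inv (hpos' t ht).ne').neg.congr_deriv (by ring)
  have hFR := intervalIntegral.integral_eq_sub_of_hasDerivAt hdR hiR
  have hend : ∀ t ∈ Set.Icc a b, ‖Complex.exp (φ t * Complex.I) / (φ' t : ℂ) * (-Complex.I)‖
      ≤ 1 / m := by
    intro t ht
    have h0 := hm.trans_le (hlow t ht)
    rw [norm_mul, norm_div, Complex.norm_exp_ofReal_mul_I, norm_neg, Complex.norm_I, mul_one,
      Complex.norm_real, Real.norm_of_nonneg h0.le]
    exact one_div_le_one_div_of_le hm (hlow t ht)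
  have hQ : ‖∫ t in a..b, Complex.exp (φ t * Complex.I) *
      ((φ'' t / φ' t ^ 2 : ℝ) : ℂ) * (-Complex.I)‖ ≤ 1 / m := by
    calc _ ≤ ∫ t in a..b, φ'' t / φ' t ^ 2 := by
          refine intervalIntegral.norm_integral_le_of_norm_le hab (ae_of_all _ fun t ht => ?_) hiR
          have ht' : t ∈ Set.Icc a b := Set.Ioc_subset_Icc_self ht
          rw [norm_mul, norm_mul, Complex.norm_exp_ofReal_mul_I, norm_neg, Complex.norm_I, mul_one,
            one_mul, Complex.norm_real, Real.norm_of_nonneg]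
          exact div_nonneg (hpos t ht') (sq_nonneg _)
      _ ≤ 1 / m := by
          rw [hFR]
          have h1 : (φ' a)⁻¹ ≤ 1 / m := by
            rw [← one_div]
            exact one_div_le_one_div_of_le hm (hlow a (Set.left_mem_Icc.2 hab))
          have h2 : 0 < (φ' b)⁻¹ :=
            inv_pos.2 (hm.trans_le (hlow b (Set.right_mem_Icc.2 hab)))
          linarith
  rw [hF]
  have e1 := hend a (Set.left_mem_Icc.2 hab)
  have e2 := hend b (Set.right_mem_Icc.2 hab)
  refine (norm_add_le _ _).trans ?_
  refine (add_le_add (norm_sub_le _ _) hQ).trans ?_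
  have : 3 / m = 1 / m + 1 / m + 1 / m := by ring
  rw [this]
  gcongr

/-- Rotating the segment `[0, R]` by the angle `θ₀` changes the integral of an entire function by
its integral over an arc, which is at most `1 / (c * R)` if the function is at most
`exp (-c * R ^ 2 * θ)` at angle `θ`. -/
theorem norm_integral_sub_integral_rotate_le {f : ℂ → ℂ} (hf : Differentiable ℂ f)
    {θ₀ R c : ℝ} (hθ : 0 ≤ θ₀) (hR : 0 < R) (hc : 0 < c)
    (hbd : ∀ θ ∈ Set.Icc 0 θ₀,
      ‖f (R * Complex.exp (θ * Complex.I))‖ ≤ Real.exp (-(c * R ^ 2) * θ)) :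
    ‖(∫ r in (0 : ℝ)..R, f r) - Complex.exp (θ₀ * Complex.I) *
      ∫ r in (0 : ℝ)..R, f (r * Complex.exp (θ₀ * Complex.I))‖ ≤ 1 / (c * R) := by
  obtain ⟨F, hF⟩ := hf.isExactOn_univ
  replace hF : ∀ w, HasDerivAt F (f w) w := fun w => hF w (Set.mem_univ w)
  have hfc := hf.continuous
  -- A primitive `F` makes all three integrals differences of values of `F`.
  have hray : ∀ w : ℂ, w * ∫ r in (0 : ℝ)..R, f (r * w) = F (R * w) - F 0 := by
    intro w
    rw [← intervalIntegral.integral_const_mul]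
    have := intervalIntegral.integral_eq_sub_of_hasDerivAt (a := 0) (b := R)
      (f := fun r : ℝ => F (r * w)) (f' := fun r : ℝ => w * f (r * w)) (fun r _ => ?_)
      (Continuous.intervalIntegrable (by fun_prop) _ _)
    · simpa using this
    · have h2 : HasDerivAt (fun r : ℝ => (r : ℂ) * w) w r := by
        simpa using ((hasDerivAt_id r).ofReal_comp).mul_const w
      exact ((hF (r * w)).comp r h2).congr_deriv (mul_comm _ _)
  have h1 := hray 1
  simp only [mul_one, one_mul] at h1
  rw [h1, hray]
  have harc : F (R * Complex.exp (θ₀ * Complex.I)) - F R = ∫ θ in (0 : ℝ)..θ₀,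
      f (R * Complex.exp (θ * Complex.I)) * (R * (Complex.exp (θ * Complex.I) * Complex.I)) := by
    symm
    have := intervalIntegral.integral_eq_sub_of_hasDerivAt (a := 0) (b := θ₀)
      (f := fun θ : ℝ => F (R * Complex.exp (θ * Complex.I)))
      (f' := fun θ : ℝ => f (R * Complex.exp (θ * Complex.I)) *
        (R * (Complex.exp (θ * Complex.I) * Complex.I))) (fun θ _ => ?_)
      (Continuous.intervalIntegrable (by fun_prop) _ _)
    · simpa using this
    · have h2 : HasDerivAt (fun θ : ℝ => (R : ℂ) * Complex.exp (θ * Complex.I))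
          (R * (Complex.exp (θ * Complex.I) * Complex.I)) θ := by
        have := (((hasDerivAt_id θ).ofReal_comp.mul_const Complex.I).cexp).const_mul (R : ℂ)
        simpa using this
      exact (hF _).comp θ h2
  rw [sub_sub_sub_cancel_right, norm_sub_rev, harc]
  have hcR : -(c * R ^ 2) ≠ 0 := by have := pow_pos hR 2; nlinarith [mul_pos hc this]
  calc _ ≤ ∫ θ in (0 : ℝ)..θ₀, R * Real.exp (-(c * R ^ 2) * θ) := by
        refine intervalIntegral.norm_integral_le_of_norm_le hθ (ae_of_all _ fun θ h => ?_)
          (Continuous.intervalIntegrable (by fun_prop) _ _)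
        rw [norm_mul, norm_mul, norm_mul, Complex.norm_exp_ofReal_mul_I, Complex.norm_I,
          Complex.norm_real, Real.norm_of_nonneg hR.le, mul_one, mul_one, mul_comm]
        exact mul_le_mul_of_nonneg_left (hbd θ (Set.Ioc_subset_Icc_self h)) hR.le
    _ = R * ((c * R ^ 2)⁻¹ * (1 - Real.exp (-(c * R ^ 2) * θ₀))) := by
        rw [intervalIntegral.integral_const_mul, intervalIntegral.integral_comp_mul_left
          (fun x => Real.exp x) hcR, integral_exp]
        simp only [smul_eq_mul, mul_zero, Real.exp_zero, inv_neg]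
        ring
    _ ≤ R * ((c * R ^ 2)⁻¹ * 1) := by
        gcongr
        linarith [Real.exp_pos (-(c * R ^ 2) * θ₀)]
    _ = 1 / (c * R) := by field_simp

/-! ### The Fresnel integral and integrals over quadrants -/

/-- The improper integral of an entire function over the positive half-line equals its integral
along a rotated ray, if it decays on the sector between them. -/
theorem tendsto_integral_rotate {f : ℂ → ℂ} (hf : Differentiable ℂ f)
    {θ₀ R₀ c : ℝ} (hθ : 0 ≤ θ₀) (hc : 0 < c)
    (hbd : ∀ R, R₀ ≤ R → ∀ θ ∈ Set.Icc 0 θ₀,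
      ‖f (R * Complex.exp (θ * Complex.I))‖ ≤ Real.exp (-(c * R ^ 2) * θ))
    (hint : IntegrableOn (fun r : ℝ => f (r * Complex.exp (θ₀ * Complex.I))) (Set.Ioi 0)) :
    Tendsto (fun R : ℝ => ∫ r in (0 : ℝ)..R, f r) atTop
      (𝓝 (Complex.exp (θ₀ * Complex.I) *
        ∫ r in Set.Ioi (0 : ℝ), f (r * Complex.exp (θ₀ * Complex.I)))) := by
  have h1 := (intervalIntegral_tendsto_integral_Ioi 0 hint tendsto_id).const_mul
    (Complex.exp (θ₀ * Complex.I))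
  have h2 : Tendsto (fun R : ℝ => (∫ r in (0 : ℝ)..R, f r) - Complex.exp (θ₀ * Complex.I) *
      ∫ r in (0 : ℝ)..R, f (r * Complex.exp (θ₀ * Complex.I))) atTop (𝓝 0) := by
    refine squeeze_zero_norm' (a := fun R : ℝ => 1 / (c * R)) ?_ ?_
    · filter_upwards [eventually_ge_atTop R₀, eventually_gt_atTop 0] with R hR hR0
      exact norm_integral_sub_integral_rotate_le hf hθ hR0 hc (hbd R hR)
    · exact tendsto_const_nhds.div_atTop (tendsto_id.const_mul_atTop hc)
  simpa using h2.add h1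

/-- Jordan's inequality, with the constant `2 / π` weakened to `1 / 2`. -/
theorem half_le_sin {x : ℝ} (h0 : 0 ≤ x) (h1 : x ≤ Real.pi / 2) : x / 2 ≤ Real.sin x := by
  refine le_trans ?_ (Real.mul_le_sin h0 h1)
  have h : 1 / 2 ≤ 2 / Real.pi := by
    rw [div_le_div_iff₀ two_pos Real.pi_pos]
    linarith [Real.pi_lt_four]
  calc x / 2 = 1 / 2 * x := by ring
    _ ≤ 2 / Real.pi * x := by gcongr

/-- The Fresnel integral `∫₀ˣ exp (3 i u²) du`. -/
noncomputable def fresnel (x : ℝ) : ℂ :=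
  ∫ u in (0 : ℝ)..x, Complex.exp (((3 * u ^ 2 : ℝ) : ℂ) * Complex.I)

/-- The value `exp (i π / 4) * √(π / 3) / 2` of the Fresnel integral over the half-line. -/
noncomputable def fresnelLimit : ℂ :=
  Complex.exp ((Real.pi / 4 : ℝ) * Complex.I) * ((√(Real.pi / 3) / 2 : ℝ) : ℂ)

theorem ofReal_mul_exp_pow (R θ : ℝ) (n : ℕ) : ((R : ℂ) * Complex.exp (θ * Complex.I)) ^ n =
    ((R ^ n * Real.cos (n * θ) : ℝ) : ℂ) + ((R ^ n * Real.sin (n * θ) : ℝ) : ℂ) * Complex.I := by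
  rw [mul_pow, ← Complex.exp_nat_mul, ← mul_assoc]
  have : ((n : ℂ) * θ) = ((n * θ : ℝ) : ℂ) := by push_cast; rfl
  rw [this, Complex.exp_mul_I]
  push_cast
  ring

theorem tendsto_fresnel : Tendsto fresnel atTop (𝓝 fresnelLimit) := by
  have hrot : ∀ r : ℝ, Complex.exp (3 * ((r : ℂ) * Complex.exp ((Real.pi / 4 : ℝ) * Complex.I)) ^ 2
      * Complex.I) = ((Real.exp (-3 * r ^ 2) : ℝ) : ℂ) := by
    intro r
    rw [ofReal_mul_exp_pow]
    have : ((2 : ℕ) : ℝ) * (Real.pi / 4) = Real.pi / 2 := by push_cast; ring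
    rw [this]
    push_cast
    simp only [Complex.cos_pi_div_two, Complex.sin_pi_div_two]
    congr 1
    linear_combination (3 * (r : ℂ) ^ 2) * Complex.I_sq
  have hi : IntegrableOn (fun r : ℝ => Real.exp (-3 * r ^ 2)) (Set.Ioi 0) :=
    (integrable_exp_neg_mul_sq (by norm_num : (0 : ℝ) < 3)).integrableOn
  have key := tendsto_integral_rotate (f := fun w => Complex.exp (3 * w ^ 2 * Complex.I))
    (θ₀ := Real.pi / 4) (R₀ := 0) (c := 3) (by fun_prop) (by positivity) (by norm_num) ?_ ?_
  · simp only [hrot] at key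
    rw [integral_complex_ofReal, integral_gaussian_Ioi] at key
    refine key.congr fun x => ?_
    unfold fresnel
    congr 1
    ext u
    push_cast
    rfl
  · intro R hR θ hθ
    rw [Complex.norm_exp, ofReal_mul_exp_pow]
    refine Real.exp_le_exp.2 ?_
    have h := half_le_sin (x := 2 * θ) (by linarith [hθ.1]) (by linarith [hθ.2])
    have : (3 * (((R ^ 2 * Real.cos ((2 : ℕ) * θ) : ℝ) : ℂ) +
        ((R ^ 2 * Real.sin ((2 : ℕ) * θ) : ℝ) : ℂ)
        * Complex.I) * Complex.I).re = - (3 * R ^ 2) * Real.sin (2 * θ) := by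
      simp [-Complex.ofReal_mul, -Complex.ofReal_pow, -Complex.ofReal_sin, -Complex.ofReal_cos]
      ring
    rw [this]
    nlinarith [mul_le_mul_of_nonneg_left h (by positivity : 0 ≤ 3 * R ^ 2)]
  · simp only [hrot]
    exact hi.ofReal

theorem norm_fresnel_sub_fresnel_le {x y : ℝ} (hx : 0 < x) (hxy : x ≤ y) :
    ‖fresnel y - fresnel x‖ ≤ 1 / (2 * x) := by
  unfold fresnel
  rw [intervalIntegral.integral_interval_sub_left]
  rotate_left
  · exact Continuous.intervalIntegrable (by fun_prop) _ _
  · exact Continuous.intervalIntegrable (by fun_prop) _ _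
  have := norm_integral_cexp_mul_I_le (φ := fun u => 3 * u ^ 2) (φ' := fun u => 6 * u)
    (φ'' := fun _ => 6) (m := 6 * x) hxy (by positivity)
    (fun t => (((hasDerivAt_id t).pow 2).const_mul 3).congr_deriv (by simp; ring))
    (fun t => ((hasDerivAt_id t).const_mul 6).congr_deriv (by simp)) (by fun_prop)
    (fun _ _ => by norm_num) (fun t ht => by linarith [ht.1])
  refine this.trans (le_of_eq ?_)
  field_simp
  norm_num

/-- The exponent `-1 / 2` makes the bound integrable at `0` and still small at infinity. -/
theorem norm_fresnelLimit_sub_fresnel_le {x : ℝ} (hx : 0 < x) :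
    ‖fresnelLimit - fresnel x‖ ≤ 2 * x ^ (-(1 / 2) : ℝ) := by
  -- Decay like `1 / x` for `x ≥ 1` and boundedness for `x ≤ 1` each imply the claimed bound.
  have hlarge : ∀ {x : ℝ}, 0 < x → ‖fresnelLimit - fresnel x‖ ≤ 1 / (2 * x) := fun {x} hx =>
    le_of_tendsto ((tendsto_fresnel.sub_const (fresnel x)).norm)
      ((eventually_ge_atTop x).mono fun y hy => norm_fresnel_sub_fresnel_le hx hy)
  rcases le_total 1 x with h | h
  · refine (hlarge hx).trans ?_
    have h1 : x ^ (-1 : ℝ) ≤ x ^ (-(1 / 2) : ℝ) :=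
      Real.rpow_le_rpow_of_exponent_le h (by norm_num)
    rw [Real.rpow_neg_one] at h1
    have h2 : 0 < x⁻¹ := inv_pos.2 hx
    have : 1 / (2 * x) = x⁻¹ / 2 := by field_simp
    rw [this]
    linarith
  · have h1 : (1 : ℝ) ≤ x ^ (-(1 / 2) : ℝ) :=
      Real.one_le_rpow_of_pos_of_le_one_of_nonpos hx h (by norm_num)
    have h2 : ‖fresnel 1 - fresnel x‖ ≤ 1 := by
      unfold fresnel
      rw [intervalIntegral.integral_interval_sub_left]
      rotate_left
      · exact Continuous.intervalIntegrable (by fun_prop) _ _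
      · exact Continuous.intervalIntegrable (by fun_prop) _ _
      refine (intervalIntegral.norm_integral_le_of_norm_le_const (C := 1) fun u _ => ?_).trans ?_
      · rw [Complex.norm_exp_ofReal_mul_I]
      · rw [abs_of_nonneg (by linarith)]; linarith
    calc ‖fresnelLimit - fresnel x‖ ≤ ‖fresnelLimit - fresnel 1‖ + ‖fresnel 1 - fresnel x‖ :=
          norm_sub_le_norm_sub_add_norm_sub _ _ _
      _ ≤ 1 / (2 * 1) + 1 := add_le_add (hlarge one_pos) h2
      _ ≤ _ := by linarith

/-- The integral of `exp (i (t³ + b t² + c t - 3 t η²))` over `0 ≤ t ≤ T`, `0 ≤ η ≤ H`; negative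
`T` and `H` are allowed, with the sign convention of interval integrals. -/
noncomputable def quarterIntegral (b c T H : ℝ) : ℂ :=
  ∫ t in (0 : ℝ)..T, ∫ η in (0 : ℝ)..H,
    Complex.exp (((t ^ 3 + b * t ^ 2 + c * t - 3 * t * η ^ 2 : ℝ) : ℂ) * Complex.I)

theorem continuous_quarterIntegral_inner (b c η₁ η₂ : ℝ) : Continuous fun t : ℝ =>
    ∫ η in η₁..η₂,
      Complex.exp (((t ^ 3 + b * t ^ 2 + c * t - 3 * t * η ^ 2 : ℝ) : ℂ) * Complex.I) :=
  intervalIntegral.continuous_parametric_intervalIntegral_of_continuous' (by fun_prop) _ _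

/-- The substitution `t = y ^ 2` evaluates the inner integral as a Fresnel integral and makes the
phase of the outer one a polynomial, without the singularity `t ^ (-1 / 2)`. -/
theorem quarterIntegral_sq (b c Y H : ℝ) :
    quarterIntegral b c (Y ^ 2) H = 2 * ∫ y in (0 : ℝ)..Y,
      Complex.exp (((y ^ 6 + b * y ^ 4 + c * y ^ 2 : ℝ) : ℂ) * Complex.I) *
        (starRingEnd ℂ) (fresnel (y * H)) := by
  have hg := continuous_quarterIntegral_inner b c 0 H
  have hsub := intervalIntegral.integral_deriv_smul_comp (a := 0) (b := Y)
    (f := fun y : ℝ => y ^ 2) (f' := fun y => 2 * y) (g := fun t : ℝ => ∫ η in (0 : ℝ)..H,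
      Complex.exp (((t ^ 3 + b * t ^ 2 + c * t - 3 * t * η ^ 2 : ℝ) : ℂ) * Complex.I))
    (fun y _ => ((hasDerivAt_id y).pow 2).congr_deriv (by simp)) (by fun_prop) hg
  unfold quarterIntegral
  rw [show ((0 : ℝ) ^ 2) = 0 by norm_num] at hsub
  rw [← hsub, ← intervalIntegral.integral_const_mul]
  refine intervalIntegral.integral_congr fun y _ => ?_
  have h1 : (starRingEnd ℂ) (fresnel (y * H)) = (y : ℂ) * ∫ η in (0 : ℝ)..H,
      Complex.exp (((-(3 * (y * η) ^ 2) : ℝ) : ℂ) * Complex.I) := by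
    have := intervalIntegral.smul_integral_comp_mul_left (a := 0) (b := H)
      (fun u : ℝ => Complex.exp (((3 * u ^ 2 : ℝ) : ℂ) * Complex.I)) y
    rw [mul_zero] at this
    unfold fresnel
    rw [← this, Complex.real_smul, map_mul, Complex.conj_ofReal,
      ← intervalIntegral.intervalIntegral_conj]
    congr 1
    refine intervalIntegral.integral_congr fun u _ => ?_
    simp only [← Complex.exp_conj, map_mul, Complex.conj_ofReal, Complex.conj_I]
    push_cast
    congr 1
    ring
  simp only [Function.comp_apply, h1, Complex.real_smul]
  rw [Complex.ofReal_mul, Complex.ofReal_ofNat, mul_left_comm (Complex.exp _), mul_assoc,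
    ← intervalIntegral.integral_const_mul (Complex.exp _)]
  congr 2
  refine intervalIntegral.integral_congr fun u _ => ?_
  simp only [← Complex.exp_add]
  congr 1
  push_cast
  ring

theorem continuous_fresnel : Continuous fresnel :=
  intervalIntegral.continuous_primitive
    (fun _ _ => Continuous.intervalIntegrable (by fun_prop) _ _) 0

/-- The error of replacing the truncated Fresnel integral by its limit; it is small as long as
`Y` is small compared with `H`. -/
theorem norm_quarterIntegral_sub_le (b c : ℝ) {Y H : ℝ} (hY : 0 ≤ Y) (hH : 0 < H) :
    ‖quarterIntegral b c (Y ^ 2) H - 2 * (starRingEnd ℂ) fresnelLimit * ∫ y in (0 : ℝ)..Y,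
      Complex.exp (((y ^ 6 + b * y ^ 4 + c * y ^ 2 : ℝ) : ℂ) * Complex.I)‖ ≤
      8 * (Y / H) ^ (1 / 2 : ℝ) := by
  have hcf := continuous_fresnel
  have hcc := Complex.continuous_conj
  rw [quarterIntegral_sq, mul_assoc, ← mul_sub, ← intervalIntegral.integral_const_mul,
    ← intervalIntegral.integral_sub]
  rotate_left
  · exact Continuous.intervalIntegrable (by fun_prop) _ _
  · exact Continuous.intervalIntegrable (by fun_prop) _ _
  have hr : (-1 : ℝ) < -(1 / 2) := by norm_num
  rw [norm_mul, Complex.norm_ofNat]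
  have : ‖∫ y in (0 : ℝ)..Y,
      (Complex.exp (((y ^ 6 + b * y ^ 4 + c * y ^ 2 : ℝ) : ℂ) * Complex.I) *
        (starRingEnd ℂ) (fresnel (y * H)) - (starRingEnd ℂ) fresnelLimit *
      Complex.exp (((y ^ 6 + b * y ^ 4 + c * y ^ 2 : ℝ) : ℂ) * Complex.I))‖ ≤
      ∫ y in (0 : ℝ)..Y, 2 * H ^ (-(1 / 2) : ℝ) * y ^ (-(1 / 2) : ℝ) := by
    refine intervalIntegral.norm_integral_le_of_norm_le hY (ae_of_all _ fun y hy => ?_)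
      ((intervalIntegral.intervalIntegrable_rpow' hr).const_mul _)
    rw [mul_comm (Complex.exp _), ← sub_mul, norm_mul, Complex.norm_exp_ofReal_mul_I, mul_one,
      ← map_sub, RCLike.norm_conj, norm_sub_rev]
    refine (norm_fresnelLimit_sub_fresnel_le (mul_pos hy.1 hH)).trans (le_of_eq ?_)
    rw [Real.mul_rpow hy.1.le hH.le]
    ring
  rw [intervalIntegral.integral_const_mul, integral_rpow (Or.inl hr)] at this
  have e1 : (-(1 / 2) : ℝ) + 1 = 1 / 2 := by norm_num
  rw [e1, Real.zero_rpow (by norm_num), sub_zero] at this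
  rw [Real.div_rpow hY hH.le]
  rw [Real.rpow_neg hH.le] at this
  calc _ ≤ 2 * (2 * (H ^ (1 / 2 : ℝ))⁻¹ * (Y ^ (1 / 2 : ℝ) / (1 / 2))) := by gcongr
    _ = _ := by ring

/-- For `t ≥ 2 * H` and `|η| ≤ H` the phase has no stationary point in `t`, so the first derivative
test applies for each fixed `η`. -/
theorem norm_quarterIntegral_sub_quarterIntegral_le (b c : ℝ) {T H : ℝ}
    (hH : 1 + |b| + |c| ≤ H) (hT : 2 * H ≤ T) :
    ‖quarterIntegral b c T H - quarterIntegral b c (2 * H) H‖ ≤ 3 / H := by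
  have hb := abs_nonneg b
  have hc := abs_nonneg c
  have hH0 : 0 < H := by linarith
  unfold quarterIntegral
  have hg := continuous_quarterIntegral_inner b c 0 H
  rw [intervalIntegral.integral_interval_sub_left (hg.intervalIntegrable _ _)
    (hg.intervalIntegrable _ _), intervalIntegral_intervalIntegral_swap]
  swap
  · have hcont : Continuous (Function.uncurry fun t η : ℝ =>
      Complex.exp (((t ^ 3 + b * t ^ 2 + c * t - 3 * t * η ^ 2 : ℝ) : ℂ) * Complex.I)) := by
      unfold Function.uncurry; fun_prop
    exact (hcont.continuousOn.integrableOn_compact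
      (isCompact_uIcc.prod isCompact_uIcc)).mono_set
      (Set.prod_mono Set.uIoc_subset_uIcc Set.uIoc_subset_uIcc)
  have key : ∀ η ∈ Set.uIoc 0 H, ‖∫ t in (2 * H)..T,
      Complex.exp (((t ^ 3 + b * t ^ 2 + c * t - 3 * t * η ^ 2 : ℝ) : ℂ) * Complex.I)‖
      ≤ 3 / H ^ 2 := by
    intro η hη
    rw [Set.uIoc_of_le hH0.le] at hη
    refine norm_integral_cexp_mul_I_le
      (φ := fun t => t ^ 3 + b * t ^ 2 + c * t - 3 * t * η ^ 2)
      (φ' := fun t => 3 * t ^ 2 + 2 * b * t + c - 3 * η ^ 2)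
      (φ'' := fun t => 6 * t + 2 * b) hT (by positivity) (fun t => ?_) (fun t => ?_)
      (by fun_prop) (fun t ht => ?_) (fun t ht => ?_)
    · have h := hasDerivAt_id t
      exact ((((h.pow 3).add ((h.pow 2).const_mul b)).add (h.const_mul c)).sub
        ((h.const_mul 3).mul_const (η ^ 2))).congr_deriv (by simp; ring)
    · have h := hasDerivAt_id t
      exact (((((h.pow 2).const_mul 3).add (h.const_mul (2 * b))).add_const c).sub_const
        (3 * η ^ 2)).congr_deriv (by simp; ring)
    · have := neg_abs_le b
      linarith [ht.1]
    · have h1 := neg_abs_le b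
      have h2 := neg_abs_le c
      have ht1 := ht.1
      have h3 : η ^ 2 ≤ H ^ 2 := pow_le_pow_left₀ hη.1.le hη.2 2
      have ht0 : 0 < t := by linarith
      have h4 : (2 * H) * t ≤ t * t := by gcongr
      have h5 : (2 * H) * (2 * H) ≤ (2 * H) * t := by gcongr
      have h6 : -|b| * t ≤ b * t := by gcongr
      have h7 : (1 + |b| + |c|) * t ≤ H * t := by gcongr
      have h8 : |c| * 1 ≤ |c| * t := by gcongr; linarith
      nlinarith
  refine (intervalIntegral.norm_integral_le_of_norm_le_const key).trans (le_of_eq ?_)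
  rw [sub_zero, abs_of_pos hH0]
  field_simp

/-! ### Convergence of the quadrant integral -/

/-- The cubic `t³ + b t² + c t`. -/
noncomputable def cubicPhase (b c t : ℂ) : ℂ := t ^ 3 + b * t ^ 2 + c * t

/-- The integral of `exp (i P(ω r²))` over `r > 0`, where `P` is `cubicPhase b c`. The
variable `r²` avoids the weight `t ^ (-1 / 2)` on the ray `t = ω r²`, and `ω ^ 3 = i` makes the
leading factor `exp (-r⁶)`. -/
noncomputable def rayIntegral (b c ω : ℂ) : ℂ :=
  ∫ r in Set.Ioi (0 : ℝ), Complex.exp (Complex.I * cubicPhase b c (ω * (r : ℂ) ^ 2))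

/-- The Gaussian `exp (-r²)` dominates the exponential of the sextic, up to a constant. -/
theorem sextic_le {A B : ℝ} (hA : 0 ≤ A) (hB : 0 ≤ B) (r : ℝ) :
    -r ^ 6 + A * r ^ 4 + B * r ^ 2 ≤ (A + B + 1) ^ 3 - r ^ 2 := by
  have hs := sq_nonneg r
  have e4 : r ^ 4 = (r ^ 2) ^ 2 := by ring
  have e6 : r ^ 6 = (r ^ 2) ^ 3 := by ring
  rw [e4, e6]
  generalize r ^ 2 = s at hs
  set K := A + B + 1 with hK
  have hK1 : 1 ≤ K := by linarith
  rcases le_total K s with h | h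
  · have h1 : s ≤ s ^ 2 := by nlinarith
    have h2 : K * s ^ 2 ≤ s * s ^ 2 := by gcongr
    have h3 : (B + 1) * s ≤ (B + 1) * s ^ 2 := by gcongr
    have h4 : 0 ≤ K ^ 3 := by positivity
    nlinarith
  · have h1 : s ^ 2 ≤ K ^ 2 := by gcongr
    have h2 : s ≤ K ^ 2 := by nlinarith
    have h3 : A * s ^ 2 ≤ A * K ^ 2 := by gcongr
    have h4 : (B + 1) * s ≤ (B + 1) * K ^ 2 := by gcongr
    have h5 : 0 ≤ s ^ 3 := by positivity
    have h6 : K ^ 3 = A * K ^ 2 + (B + 1) * K ^ 2 := by rw [hK]; ring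
    linarith

theorem norm_exp_I_mul_cubicPhase_le (b c : ℂ) {ω : ℂ} (h3 : ω ^ 3 = Complex.I)
    (h1 : ‖ω‖ = 1) (r : ℝ) :
    ‖Complex.exp (Complex.I * cubicPhase b c (ω * (r : ℂ) ^ 2))‖ ≤
      Real.exp (-r ^ 6 + ‖b‖ * r ^ 4 + ‖c‖ * r ^ 2) := by
  rw [Complex.norm_exp]
  refine Real.exp_le_exp.2 ?_
  have e : Complex.I * cubicPhase b c (ω * (r : ℂ) ^ 2) = ((-r ^ 6 : ℝ) : ℂ) +
      (Complex.I * (b * ω ^ 2 * (r : ℂ) ^ 4) + Complex.I * (c * ω * (r : ℂ) ^ 2)) := by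
    unfold cubicPhase
    push_cast
    linear_combination (Complex.I * (r : ℂ) ^ 6) * h3 + (r : ℂ) ^ 6 * Complex.I_sq
  rw [e, Complex.add_re, Complex.add_re, Complex.ofReal_re, add_assoc]
  have hr2 : ‖(r : ℂ)‖ ^ 2 = r ^ 2 := by rw [Complex.norm_real, Real.norm_eq_abs, sq_abs]
  have hr4 : ‖(r : ℂ)‖ ^ 4 = r ^ 4 := by
    rw [show ‖(r : ℂ)‖ ^ 4 = (‖(r : ℂ)‖ ^ 2) ^ 2 by ring, hr2]; ring
  gcongr
  · refine (Complex.re_le_norm _).trans (le_of_eq ?_)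
    simp only [norm_mul, norm_pow, Complex.norm_I, h1, hr4]
    ring
  · refine (Complex.re_le_norm _).trans (le_of_eq ?_)
    simp only [norm_mul, norm_pow, Complex.norm_I, h1, hr2]
    ring

theorem norm_exp_I_mul_cubicPhase_le_gaussian (b c : ℂ) {ω : ℂ} (h3 : ω ^ 3 = Complex.I)
    (h1 : ‖ω‖ = 1) (r : ℝ) :
    ‖Complex.exp (Complex.I * cubicPhase b c (ω * (r : ℂ) ^ 2))‖ ≤
      Real.exp ((‖b‖ + ‖c‖ + 1) ^ 3) * Real.exp (-r ^ 2) := by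
  refine (norm_exp_I_mul_cubicPhase_le b c h3 h1 r).trans ?_
  rw [← Real.exp_add, ← sub_eq_add_neg]
  exact Real.exp_le_exp.2 (sextic_le (norm_nonneg _) (norm_nonneg _) r)

theorem integrableOn_exp_neg_sq : IntegrableOn (fun r : ℝ => Real.exp (-r ^ 2)) (Set.Ioi 0) := by
  simpa using (integrable_exp_neg_mul_sq one_pos).integrableOn (s := Set.Ioi 0)

theorem integrableOn_exp_cubicPhase (b c : ℂ) {ω : ℂ} (h3 : ω ^ 3 = Complex.I)
    (h1 : ‖ω‖ = 1) :
    IntegrableOn (fun r : ℝ => Complex.exp (Complex.I * cubicPhase b c (ω * (r : ℂ) ^ 2)))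
      (Set.Ioi 0) := by
  refine (integrableOn_exp_neg_sq.const_mul (Real.exp ((‖b‖ + ‖c‖ + 1) ^ 3))).mono' ?_ ?_
  · unfold cubicPhase
    exact Continuous.aestronglyMeasurable (by fun_prop)
  · exact ae_of_all _ fun r => norm_exp_I_mul_cubicPhase_le_gaussian b c h3 h1 r

theorem exp_pi_div_six_pow_three :
    Complex.exp ((Real.pi / 6 : ℝ) * Complex.I) ^ 3 = Complex.I := by
  conv_rhs => rw [← Complex.exp_pi_div_two_mul_I]
  rw [← Complex.exp_nat_mul]
  congr 1
  push_cast
  ring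

theorem tendsto_integral_exp_sextic (b c : ℝ) :
    Tendsto (fun Y : ℝ => ∫ y in (0 : ℝ)..Y,
      Complex.exp (((y ^ 6 + b * y ^ 4 + c * y ^ 2 : ℝ) : ℂ) * Complex.I)) atTop
      (𝓝 (Complex.exp ((Real.pi / 12 : ℝ) * Complex.I) *
        rayIntegral b c (Complex.exp ((Real.pi / 6 : ℝ) * Complex.I)))) := by
  have hrot : ∀ r : ℝ, Complex.I * cubicPhase b c
      (((r : ℂ) * Complex.exp ((Real.pi / 12 : ℝ) * Complex.I)) ^ 2) = Complex.I * cubicPhase b c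
      (Complex.exp ((Real.pi / 6 : ℝ) * Complex.I) * (r : ℂ) ^ 2) := by
    intro r
    rw [mul_pow, ← Complex.exp_nat_mul, mul_comm ((r : ℂ) ^ 2)]
    congr 4
    push_cast
    ring
  have key := tendsto_integral_rotate
    (f := fun w => Complex.exp (Complex.I * cubicPhase b c (w ^ 2)))
    (θ₀ := Real.pi / 12) (R₀ := 1 + |b| + |c|) (c := 1) (by unfold cubicPhase; fun_prop)
    (by positivity) (by norm_num) ?_ ?_
  · simp only [hrot] at key
    refine key.congr fun x => ?_
    congr 1
    ext u
    unfold cubicPhase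
    push_cast
    congr 1
    ring
  · intro R hR θ hθ
    have hb := abs_nonneg b
    have hc := abs_nonneg c
    rw [Complex.norm_exp]
    refine Real.exp_le_exp.2 ?_
    have e : cubicPhase b c (((R : ℂ) * Complex.exp (θ * Complex.I)) ^ 2) =
        ((R : ℂ) * Complex.exp (θ * Complex.I)) ^ 6 +
        b * ((R : ℂ) * Complex.exp (θ * Complex.I)) ^ 4 +
        c * ((R : ℂ) * Complex.exp (θ * Complex.I)) ^ 2 := by unfold cubicPhase; ring
    rw [e, ofReal_mul_exp_pow, ofReal_mul_exp_pow, ofReal_mul_exp_pow]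
    have hre : (Complex.I * (((R ^ 6 * Real.cos ((6 : ℕ) * θ) : ℝ) : ℂ) +
        ((R ^ 6 * Real.sin ((6 : ℕ) * θ) : ℝ) : ℂ) * Complex.I +
        b * (((R ^ 4 * Real.cos ((4 : ℕ) * θ) : ℝ) : ℂ) +
        ((R ^ 4 * Real.sin ((4 : ℕ) * θ) : ℝ) : ℂ) * Complex.I) +
        c * (((R ^ 2 * Real.cos ((2 : ℕ) * θ) : ℝ) : ℂ) +
        ((R ^ 2 * Real.sin ((2 : ℕ) * θ) : ℝ) : ℂ) * Complex.I))).re =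
        -(R ^ 6 * Real.sin (6 * θ) + b * (R ^ 4 * Real.sin (4 * θ)) +
          c * (R ^ 2 * Real.sin (2 * θ))) := by
      simp [-Complex.ofReal_mul, -Complex.ofReal_pow, -Complex.ofReal_sin, -Complex.ofReal_cos]
    rw [hre]
    obtain ⟨h0, h1⟩ := hθ
    -- On `[0, π / 12]` the two other sines are nonnegative and at most `sin (6 * θ)`, so the term
    -- of degree `6` dominates for large `R`.
    have hs6 := half_le_sin (x := 6 * θ) (by linarith) (by linarith)
    have hs4 : 0 ≤ Real.sin (4 * θ) :=
      (by linarith : (0 : ℝ) ≤ 4 * θ / 2).trans (half_le_sin (by linarith) (by linarith))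
    have hs2 : 0 ≤ Real.sin (2 * θ) :=
      (by linarith : (0 : ℝ) ≤ 2 * θ / 2).trans (half_le_sin (by linarith) (by linarith))
    have hpi := Real.pi_pos
    have hm4 : Real.sin (4 * θ) ≤ Real.sin (6 * θ) :=
      Real.sin_le_sin_of_le_of_le_pi_div_two (by linarith) (by linarith) (by linarith)
    have hm2 : Real.sin (2 * θ) ≤ Real.sin (6 * θ) :=
      Real.sin_le_sin_of_le_of_le_pi_div_two (by linarith) (by linarith) (by linarith)
    have hR1 : 1 ≤ R := by linarith
    set s := Real.sin (6 * θ)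
    have hs : 0 ≤ s := by linarith
    have b4 : -(b * (R ^ 4 * Real.sin (4 * θ))) ≤ |b| * (R ^ 4 * s) := by
      rw [← neg_mul]
      exact mul_le_mul (neg_le_abs b) (by gcongr) (by positivity) hb
    have c2 : -(c * (R ^ 2 * Real.sin (2 * θ))) ≤ |c| * (R ^ 2 * s) := by
      rw [← neg_mul]
      exact mul_le_mul (neg_le_abs c) (by gcongr) (by positivity) hc
    have hR2 : R ≤ R ^ 2 := by nlinarith
    have hRR : 1 ≤ R ^ 2 := by linarith
    have hpoly : R ^ 2 ≤ R ^ 6 - |b| * R ^ 4 - |c| * R ^ 2 := by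
      have g1 : (1 + |b| + |c|) * R ^ 2 ≤ R ^ 2 * R ^ 2 := by gcongr; linarith
      have g2 : |c| * 1 ≤ |c| * R ^ 2 := by gcongr
      have g3 : 1 ≤ R ^ 4 - |b| * R ^ 2 - |c| := by nlinarith
      have g4 : R ^ 2 * 1 ≤ R ^ 2 * (R ^ 4 - |b| * R ^ 2 - |c|) := by gcongr
      linarith
    have f1 : R ^ 2 * s ≤ (R ^ 6 - |b| * R ^ 4 - |c| * R ^ 2) * s := by gcongr
    have f2 : R ^ 2 * θ ≤ R ^ 2 * s := by gcongr; linarith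
    linarith
  · simp only [hrot]
    exact integrableOn_exp_cubicPhase b c exp_pi_div_six_pow_three
      (Complex.norm_exp_ofReal_mul_I _)

/-- The limit is joint: `T` is first replaced by `min T (2 * H)`, which makes the Fresnel error
small and still tends to infinity. -/
theorem tendsto_quarterIntegral (b c : ℝ) :
    Tendsto (fun p : ℝ × ℝ => quarterIntegral b c p.1 p.2) (atTop ×ˢ atTop)
      (𝓝 ((√(Real.pi / 3) : ℂ) * Complex.exp (-(Real.pi / 6 : ℝ) * Complex.I) *
        rayIntegral b c (Complex.exp ((Real.pi / 6 : ℝ) * Complex.I)))) := by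
  have h1 : Tendsto (fun p : ℝ × ℝ => √(min p.1 (2 * p.2))) (atTop ×ˢ atTop) atTop := by
    refine Real.tendsto_sqrt_atTop.comp ?_
    refine tendsto_atTop.2 fun M => ?_
    filter_upwards [tendsto_fst.eventually (eventually_ge_atTop M),
      ((tendsto_id.const_mul_atTop two_pos).comp tendsto_snd).eventually
        (eventually_ge_atTop M)] with p h1 h2
    exact le_min h1 h2
  have h2 := ((tendsto_integral_exp_sextic b c).comp h1).const_mul
    (2 * (starRingEnd ℂ) fresnelLimit)
  have h3 : Tendsto (fun p : ℝ × ℝ => quarterIntegral b c p.1 p.2 -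
      2 * (starRingEnd ℂ) fresnelLimit * ∫ y in (0 : ℝ)..√(min p.1 (2 * p.2)),
      Complex.exp (((y ^ 6 + b * y ^ 4 + c * y ^ 2 : ℝ) : ℂ) * Complex.I))
      (atTop ×ˢ atTop) (𝓝 0) := by
    refine squeeze_zero_norm'
      (a := fun p : ℝ × ℝ => 3 / p.2 + 8 * (√2 / √p.2) ^ (1 / 2 : ℝ)) ?_ ?_
    · filter_upwards [tendsto_fst.eventually (eventually_ge_atTop 0),
        tendsto_snd.eventually (eventually_ge_atTop (1 + |b| + |c|))] with ⟨T, H⟩ hT hH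
      simp only at hT hH ⊢
      have hH0 : 0 < H := by have := abs_nonneg b; have := abs_nonneg c; linarith
      have hm : 0 ≤ min T (2 * H) := le_min hT (by positivity)
      have k1 : ‖quarterIntegral b c T H - quarterIntegral b c (min T (2 * H)) H‖ ≤ 3 / H := by
        rcases le_total T (2 * H) with h | h
        · rw [min_eq_left h, sub_self, norm_zero]
          positivity
        · rw [min_eq_right h]
          exact norm_quarterIntegral_sub_quarterIntegral_le b c hH h
      have k2 := norm_quarterIntegral_sub_le b c (Real.sqrt_nonneg (min T (2 * H))) hH0
      rw [Real.sq_sqrt hm] at k2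
      refine (norm_sub_le_norm_sub_add_norm_sub _ _ _).trans
        (add_le_add k1 (k2.trans ?_))
      gcongr 8 * ?_ ^ _
      have : √2 / √H = √(2 * H) / H := by
        rw [Real.sqrt_mul zero_le_two, div_eq_div_iff (Real.sqrt_pos.2 hH0).ne' hH0.ne', mul_assoc,
          Real.mul_self_sqrt hH0.le]
      rw [this]
      gcongr
      exact min_le_right _ _
    · have e1 : Tendsto (fun H : ℝ => 3 / H) atTop (𝓝 0) :=
        tendsto_const_nhds.div_atTop tendsto_id
      have e2 : Tendsto (fun H : ℝ => √2 / √H) atTop (𝓝 0) :=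
        tendsto_const_nhds.div_atTop Real.tendsto_sqrt_atTop
      have e3 := (e2.rpow_const (p := (1 / 2 : ℝ)) (Or.inr (by norm_num))).const_mul 8
      have e4 := e1.add e3
      rw [Real.zero_rpow (by norm_num), mul_zero, add_zero] at e4
      exact e4.comp tendsto_snd
  have h4 := h3.add h2
  simp only [Function.comp_apply, sub_add_cancel, zero_add] at h4
  convert h4 using 2
  rw [← mul_assoc]
  congr 1
  unfold fresnelLimit
  rw [map_mul, Complex.conj_ofReal, ← Complex.exp_conj, map_mul, Complex.conj_ofReal,
    Complex.conj_I]
  have : Complex.exp (-(Real.pi / 6 : ℝ) * Complex.I) = Complex.exp ((Real.pi / 4 : ℝ) * -Complex.I)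
      * Complex.exp ((Real.pi / 12 : ℝ) * Complex.I) := by
    rw [← Complex.exp_add]
    congr 1
    push_cast
    ring
  rw [this]
  push_cast
  ring

/-! ### Reduction of the double integral to integrals along rays -/

theorem quarterIntegral_neg_right (b c T H : ℝ) :
    quarterIntegral b c T (-H) = -quarterIntegral b c T H := by
  unfold quarterIntegral
  rw [← intervalIntegral.integral_neg]
  congr 1
  ext t
  rw [intervalIntegral.integral_symm, ← neg_zero, ← intervalIntegral.integral_comp_neg]
  simp

theorem quarterIntegral_neg_left (b c T H : ℝ) :
    quarterIntegral b c (-T) H = -(starRingEnd ℂ) (quarterIntegral (-b) c T H) := by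
  unfold quarterIntegral
  rw [← intervalIntegral.intervalIntegral_conj, intervalIntegral.integral_symm]
  nth_rw 2 [← neg_zero]
  rw [← intervalIntegral.integral_comp_neg]
  congr 1
  refine intervalIntegral.integral_congr fun t _ => ?_
  rw [← intervalIntegral.intervalIntegral_conj]
  refine intervalIntegral.integral_congr fun η _ => ?_
  rw [← Complex.exp_conj, map_mul, Complex.conj_ofReal, Complex.conj_I]
  congr 1
  push_cast
  ring

/-- The rectangle is cut along the axes; the half-plane `t < 0` is reflected to `t > 0` by complex
conjugation. -/
theorem integral_rectangle_eq (b c t₁ t₂ η₁ η₂ : ℝ) :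
    (∫ t in t₁..t₂, ∫ η in η₁..η₂,
      Complex.exp (((t ^ 3 + b * t ^ 2 + c * t - 3 * t * η ^ 2 : ℝ) : ℂ) * Complex.I)) =
    quarterIntegral b c t₂ η₂ + quarterIntegral b c t₂ (-η₁) +
      (starRingEnd ℂ) (quarterIntegral (-b) c (-t₁) η₂) +
      (starRingEnd ℂ) (quarterIntegral (-b) c (-t₁) (-η₁)) := by
  have h1 : ∀ η, (∫ t in t₁..t₂, ∫ η in (0 : ℝ)..η,
      Complex.exp (((t ^ 3 + b * t ^ 2 + c * t - 3 * t * η ^ 2 : ℝ) : ℂ) * Complex.I)) =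
      quarterIntegral b c t₂ η - quarterIntegral b c t₁ η := by
    intro η
    have hc := continuous_quarterIntegral_inner b c 0 η
    unfold quarterIntegral
    rw [intervalIntegral.integral_interval_sub_left (hc.intervalIntegrable _ _)
      (hc.intervalIntegrable _ _)]
  have h2 : ∀ η, quarterIntegral b c t₁ η =
      -(starRingEnd ℂ) (quarterIntegral (-b) c (-t₁) η) := by
    intro η
    rw [← quarterIntegral_neg_left, neg_neg]
  have h3 : ∀ t : ℝ, (∫ η in η₁..η₂,
      Complex.exp (((t ^ 3 + b * t ^ 2 + c * t - 3 * t * η ^ 2 : ℝ) : ℂ) * Complex.I)) =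
      (∫ η in (0 : ℝ)..η₂,
      Complex.exp (((t ^ 3 + b * t ^ 2 + c * t - 3 * t * η ^ 2 : ℝ) : ℂ) * Complex.I)) -
      ∫ η in (0 : ℝ)..η₁,
      Complex.exp (((t ^ 3 + b * t ^ 2 + c * t - 3 * t * η ^ 2 : ℝ) : ℂ) * Complex.I) := by
    intro t
    rw [intervalIntegral.integral_interval_sub_left] <;>
      exact Continuous.intervalIntegrable (by fun_prop) _ _
  simp only [h3]
  rw [intervalIntegral.integral_sub
    ((continuous_quarterIntegral_inner b c 0 η₂).intervalIntegrable _ _)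
    ((continuous_quarterIntegral_inner b c 0 η₁).intervalIntegrable _ _), h1, h1, h2 η₂, h2 η₁,
    quarterIntegral_neg_right, quarterIntegral_neg_right, map_neg]
  ring

theorem fourierTrunc_umbilicDistribution (x z : ℝ) {p : (ℝ × ℝ) × (ℝ × ℝ)}
    (h₁ : p.1.1 ≤ p.2.1) (h₂ : p.1.2 ≤ p.2.2) :
    fourierTrunc (umbilicDistribution z) x 0 p = 1 / (2 * (Real.pi : ℂ)) *
      (Complex.exp ((x * z / 3 - 4 * z ^ 3 / 27 : ℝ) * Complex.I) *
      ∫ t in (p.1.1 + z / 3)..(p.2.1 + z / 3), ∫ η in p.1.2..p.2.2,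
      Complex.exp (((t ^ 3 + (-2 * z) * t ^ 2 + (z ^ 2 - x) * t - 3 * t * η ^ 2 : ℝ) : ℂ)
        * Complex.I)) := by
  obtain ⟨⟨ξ₁, η₁⟩, ⟨ξ₂, η₂⟩⟩ := p
  simp only at h₁ h₂
  unfold fourierTrunc
  congr 1
  simp only
  rw [← intervalIntegral.integral_comp_add_right (fun t : ℝ => ∫ η in η₁..η₂,
      Complex.exp (((t ^ 3 + (-2 * z) * t ^ 2 + (z ^ 2 - x) * t - 3 * t * η ^ 2 : ℝ) : ℂ)
        * Complex.I)), ← intervalIntegral.integral_const_mul, ← Set.Icc_prod_Icc,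
    Measure.volume_eq_prod, setIntegral_prod, integral_Icc_eq_integral_Ioc,
    ← intervalIntegral.integral_of_le h₁]
  · refine intervalIntegral.integral_congr fun ξ _ => ?_
    simp only
    rw [integral_Icc_eq_integral_Ioc, ← intervalIntegral.integral_of_le h₂,
      ← intervalIntegral.integral_const_mul]
    refine intervalIntegral.integral_congr fun η _ => ?_
    simp only [umbilicDistribution]
    rw [← Complex.exp_add, ← Complex.exp_add]
    congr 1
    push_cast
    ring
  · refine ContinuousOn.integrableOn_compact (isCompact_Icc.prod isCompact_Icc) ?_
    unfold umbilicDistribution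
    fun_prop

/-- Conjugation interchanges the two rays, `ω = exp (i π / 6)` and `ω = -exp (-i π / 6)`, on which
`ω ^ 3 = i`. -/
theorem conj_rayIntegral_neg (b c : ℝ) (ω : ℂ) :
    (starRingEnd ℂ) (rayIntegral ((-b : ℝ) : ℂ) c ω) = rayIntegral b c (-(starRingEnd ℂ) ω) := by
  unfold rayIntegral cubicPhase
  rw [← integral_conj]
  congr 1
  ext r
  rw [← Complex.exp_conj]
  congr 1
  simp only [map_mul, map_add, map_pow, Complex.conj_ofReal, Complex.conj_I]
  push_cast
  ring

/-- The improper double integral converges at every `(x, 0)`, and it is a combination of the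
absolutely convergent integrals along the rays `arg t = π / 6` and `arg t = 5 π / 6`. -/
theorem hasFourierTransformAt_umbilicDistribution (x z : ℝ) :
    HasFourierTransformAt (umbilicDistribution z) x 0
      (Complex.exp ((x * z / 3 - 4 * z ^ 3 / 27 : ℝ) * Complex.I) * √(Real.pi / 3) / Real.pi *
      (Complex.exp (-(Real.pi / 6 : ℝ) * Complex.I) * rayIntegral ((-2 * z : ℝ) : ℂ)
        ((z ^ 2 - x : ℝ) : ℂ) (Complex.exp ((Real.pi / 6 : ℝ) * Complex.I)) +
      Complex.exp ((Real.pi / 6 : ℝ) * Complex.I) * rayIntegral ((-2 * z : ℝ) : ℂ)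
        ((z ^ 2 - x : ℝ) : ℂ) (-Complex.exp (-(Real.pi / 6 : ℝ) * Complex.I)))) := by
  unfold HasFourierTransformAt
  set b : ℝ := -2 * z
  set c : ℝ := z ^ 2 - x
  have hbot : (atBot : Filter (ℝ × ℝ)) = atBot ×ˢ atBot := prod_atBot_atBot_eq.symm
  have htop : (atTop : Filter (ℝ × ℝ)) = atTop ×ˢ atTop := prod_atTop_atTop_eq.symm
  have t11 : Tendsto (fun p : (ℝ × ℝ) × (ℝ × ℝ) => p.1.1) (atBot ×ˢ atTop) atBot := by
    rw [hbot]; exact tendsto_fst.comp tendsto_fst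
  have t12 : Tendsto (fun p : (ℝ × ℝ) × (ℝ × ℝ) => p.1.2) (atBot ×ˢ atTop) atBot := by
    rw [hbot]; exact tendsto_snd.comp tendsto_fst
  have t21 : Tendsto (fun p : (ℝ × ℝ) × (ℝ × ℝ) => p.2.1) (atBot ×ˢ atTop) atTop := by
    rw [htop]; exact tendsto_fst.comp tendsto_snd
  have t22 : Tendsto (fun p : (ℝ × ℝ) × (ℝ × ℝ) => p.2.2) (atBot ×ˢ atTop) atTop := by
    rw [htop]; exact tendsto_snd.comp tendsto_snd
  have s11 := tendsto_neg_atBot_atTop.comp (tendsto_atBot_add_const_right _ (z / 3) t11)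
  have s12 := tendsto_neg_atBot_atTop.comp t12
  have s21 := tendsto_atTop_add_const_right _ (z / 3) t21
  have q := tendsto_quarterIntegral b c
  have q' := (Complex.continuous_conj.tendsto _).comp (tendsto_quarterIntegral (-b) c)
  have hl := ((((q.comp (s21.prodMk t22)).add (q.comp (s21.prodMk s12))).add
    (q'.comp (s11.prodMk t22))).add (q'.comp (s11.prodMk s12))).const_mul
    (Complex.exp ((x * z / 3 - 4 * z ^ 3 / 27 : ℝ) * Complex.I))
  have hl' := hl.const_mul (1 / (2 * (Real.pi : ℂ)))
  refine (hl'.congr' ?_).trans (le_of_eq (congrArg 𝓝 ?_))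
  · filter_upwards [t11.eventually (eventually_le_atBot 0), t12.eventually (eventually_le_atBot 0),
      t21.eventually (eventually_ge_atTop 0), t22.eventually (eventually_ge_atTop 0)]
      with p h11 h12 h21 h22
    rw [fourierTrunc_umbilicDistribution x z (h11.trans h21) (h12.trans h22),
      integral_rectangle_eq]
    rfl
  · have hπ : (Real.pi : ℂ) ≠ 0 := Complex.ofReal_ne_zero.2 Real.pi_ne_zero
    rw [map_mul, map_mul, Complex.conj_ofReal, conj_rayIntegral_neg, ← Complex.exp_conj,
      ← Complex.exp_conj]
    simp only [map_mul, map_neg, Complex.conj_ofReal, Complex.conj_I, mul_neg, neg_mul, neg_neg]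
    field_simp
    ring

/-! ### Gamma integrals and the phase without linear term -/

theorem HasSum.eq_add_of_mod_three {f : ℕ → ℂ} {s A B : ℂ} (hf : HasSum f s)
    (hA : HasSum (fun k => f (3 * k)) A) (hB : HasSum (fun k => f (3 * k + 1)) B)
    (h2 : ∀ k, f (3 * k + 2) = 0) : s = A + B := by
  have h := (Nat.divModEquiv 3).symm.hasSum_iff.mpr hf
  have h' := h.prod_fiberwise fun k => hasSum_fintype _
  refine h'.unique ((hA.add hB).congr_fun fun k => ?_)
  simp [Fin.sum_univ_three, Nat.divModEquiv, mul_comm k 3, h2]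

theorem integral_pow_mul_exp_neg_pow_six (m : ℕ) :
    ∫ r in Set.Ioi (0 : ℝ), (r : ℂ) ^ m * Complex.exp (-(r : ℂ) ^ 6) =
      Complex.Gamma ((m + 1) / 6) / 6 := by
  have h := integral_rpow_mul_exp_neg_rpow (p := 6) (q := m) (by norm_num)
    (by have : (0 : ℝ) ≤ m := Nat.cast_nonneg m
        linarith)
  have h2 := congrArg (fun x : ℝ => (x : ℂ)) h
  rw [← integral_complex_ofReal] at h2
  have e6 : ∀ r : ℝ, r ^ (6 : ℝ) = r ^ 6 := fun r => by
    rw [← Real.rpow_natCast]; norm_num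
  simp only [Real.rpow_natCast, e6] at h2
  push_cast at h2
  have h3 := Complex.Gamma_ofReal ((m + 1) / 6 : ℝ)
  push_cast at h3
  rw [h2, h3]
  ring

/-- The duplication formula for the Pochhammer symbol `(s)_{2k}`. -/
theorem Gamma_two_mul_add {s : ℂ} (hs : 0 < s.re) (k : ℕ) :
    Complex.Gamma (2 * k + s) = Complex.Gamma s *
      (4 ^ k * ((ascPochhammer ℂ k).eval (s / 2) * (ascPochhammer ℂ k).eval ((s + 1) / 2))) := by
  induction k with
  | zero => simp
  | succ k ih =>
    have h0 : (2 * k + s : ℂ) ≠ 0 := fun h => by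
      have := congrArg Complex.re h
      simp at this
      have hk : (0 : ℝ) ≤ k := Nat.cast_nonneg k
      linarith
    have h1 : (2 * k + s + 1 : ℂ) ≠ 0 := fun h => by
      have := congrArg Complex.re h
      simp at this
      have hk : (0 : ℝ) ≤ k := Nat.cast_nonneg k
      linarith
    have e : (2 * ((k + 1 : ℕ) : ℂ) + s) = 2 * k + s + 1 + 1 := by push_cast; ring
    rw [e, Complex.Gamma_add_one _ h1, Complex.Gamma_add_one _ h0, ih, ascPochhammer_succ_eval,
      ascPochhammer_succ_eval, pow_succ]
    ring

/-- The triplication formula for factorials. -/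
theorem factorial_three_mul (k : ℕ) : ((3 * k).factorial : ℂ) =
    27 ^ k * ((ascPochhammer ℂ k).eval (1 / 3) * (ascPochhammer ℂ k).eval (2 / 3) *
      k.factorial) := by
  induction k with
  | zero => simp
  | succ k ih =>
    rw [show 3 * (k + 1) = 3 * k + 1 + 1 + 1 by ring, Nat.factorial_succ, Nat.factorial_succ,
      Nat.factorial_succ, Nat.factorial_succ]
    push_cast
    rw [ih, ascPochhammer_succ_eval, ascPochhammer_succ_eval, pow_succ]
    ring

theorem factorial_three_mul_add_one (k : ℕ) : ((3 * k + 1).factorial : ℂ) =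
    27 ^ k * ((ascPochhammer ℂ k).eval (2 / 3) * (ascPochhammer ℂ k).eval (4 / 3) *
      k.factorial) := by
  induction k with
  | zero => simp
  | succ k ih =>
    rw [show 3 * (k + 1) + 1 = 3 * k + 1 + 1 + 1 + 1 by ring, Nat.factorial_succ,
      Nat.factorial_succ, Nat.factorial_succ, Nat.factorial_succ k]
    push_cast
    rw [ih, ascPochhammer_succ_eval, ascPochhammer_succ_eval, pow_succ]
    ring

theorem ne_neg_natCast_of_re_pos {x : ℂ} (hx : 0 < x.re) (k : ℕ) : x ≠ -k := fun h => by
  have := congrArg Complex.re h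
  simp at this
  have hk : (0 : ℝ) ≤ k := Nat.cast_nonneg k
  linarith

/-- A power series with denominators `(3 k)!` is a `₂F₂` at a 27th of its argument. -/
theorem hasSum_pow_div_factorial_three_mul (a₁ a₂ u : ℂ) :
    HasSum (fun k : ℕ => u ^ k * ((ascPochhammer ℂ k).eval a₁ * (ascPochhammer ℂ k).eval a₂) /
      (3 * k).factorial) (hypergeometric2F2 a₁ a₂ (1 / 3) (2 / 3) (u / 27)) := by
  refine (hasSum_hypergeometric2F2 a₁ a₂ (1 / 3) (2 / 3) (u / 27)
    (ne_neg_natCast_of_re_pos (by norm_num))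
    (ne_neg_natCast_of_re_pos (by norm_num))).congr_fun fun k => ?_
  rw [factorial_three_mul, div_pow]
  rw [div_mul_div_comm, mul_comm _ (u ^ k), mul_comm (27 ^ k : ℂ)]

theorem hasSum_pow_div_factorial_three_mul_add_one (a₁ a₂ u : ℂ) :
    HasSum (fun k : ℕ => u ^ k * ((ascPochhammer ℂ k).eval a₁ * (ascPochhammer ℂ k).eval a₂) /
      (3 * k + 1).factorial) (hypergeometric2F2 a₁ a₂ (2 / 3) (4 / 3) (u / 27)) := by
  refine (hasSum_hypergeometric2F2 a₁ a₂ (2 / 3) (4 / 3) (u / 27)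
    (ne_neg_natCast_of_re_pos (by norm_num))
    (ne_neg_natCast_of_re_pos (by norm_num))).congr_fun fun k => ?_
  rw [factorial_three_mul_add_one, div_pow]
  rw [div_mul_div_comm, mul_comm _ (u ^ k), mul_comm (27 ^ k : ℂ)]

theorem hasSum_rayIntegral_zero_right (b : ℂ) {ω : ℂ} (h3 : ω ^ 3 = Complex.I)
    (h1 : ‖ω‖ = 1) :
    HasSum (fun n : ℕ => (Complex.I * b * ω ^ 2) ^ n / n.factorial *
      (Complex.Gamma ((4 * n + 1) / 6) / 6)) (rayIntegral b 0 ω) := by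
  have hexp : ∀ r : ℝ, HasSum (fun n : ℕ => Real.exp (-r ^ 6) * ((‖b‖ * r ^ 4) ^ n / n.factorial))
      (Real.exp (-r ^ 6 + ‖b‖ * r ^ 4)) := fun r => by
    rw [Real.exp_add, Real.exp_eq_exp_ℝ]
    exact (NormedSpace.expSeries_div_hasSum_exp (‖b‖ * r ^ 4)).mul_left _
  have key : HasSum (fun n : ℕ => ∫ r in Set.Ioi (0 : ℝ),
      (Complex.I * b * ω ^ 2) ^ n / n.factorial *
      ((r : ℂ) ^ (4 * n) * Complex.exp (-(r : ℂ) ^ 6))) (rayIntegral b 0 ω) := by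
    refine hasSum_integral_of_dominated_convergence
      (fun n r => Real.exp (-r ^ 6) * ((‖b‖ * r ^ 4) ^ n / n.factorial))
      (fun n => Continuous.aestronglyMeasurable (by fun_prop)) (fun n => ae_of_all _ fun r => ?_)
      (ae_of_all _ fun r => (hexp r).summable) ?_ (ae_of_all _ fun r => ?_)
    · rw [norm_mul, norm_mul, Complex.norm_exp, norm_div, norm_pow, norm_pow, norm_mul, norm_mul,
        norm_pow, h1, Complex.norm_I, Complex.norm_natCast, Complex.norm_real, pow_mul,
        show ‖r‖ ^ 4 = r ^ 4 by
          rw [Real.norm_eq_abs, show |r| ^ 4 = (|r| ^ 2) ^ 2 by ring, sq_abs]; ring]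
      rw [show (-(r : ℂ) ^ 6).re = -r ^ 6 by
        rw [← Complex.ofReal_pow, ← Complex.ofReal_neg, Complex.ofReal_re]]
      apply le_of_eq
      rw [mul_pow]
      ring
    · simp only [fun r => (hexp r).tsum_eq]
      refine (integrableOn_exp_neg_sq.const_mul (Real.exp ((‖b‖ + 0 + 1) ^ 3))).mono'
        (Continuous.aestronglyMeasurable (by fun_prop)) (ae_of_all _ fun r => ?_)
      rw [Real.norm_of_nonneg (Real.exp_pos _).le, ← Real.exp_add]
      refine Real.exp_le_exp.2 ?_
      have := sextic_le (norm_nonneg b) le_rfl r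
      linarith
    · have e : Complex.I * cubicPhase b 0 (ω * (r : ℂ) ^ 2) =
          -(r : ℂ) ^ 6 + Complex.I * b * ω ^ 2 * (r : ℂ) ^ 4 := by
        unfold cubicPhase
        linear_combination (Complex.I * (r : ℂ) ^ 6) * h3 + (r : ℂ) ^ 6 * Complex.I_sq
      rw [e, Complex.exp_add, Complex.exp_eq_exp_ℂ]
      refine ((NormedSpace.expSeries_div_hasSum_exp
        (Complex.I * b * ω ^ 2 * (r : ℂ) ^ 4)).mul_left _).congr_fun fun n => ?_
      rw [mul_pow, pow_mul]
      ring
  refine key.congr_fun fun n => ?_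
  rw [integral_const_mul, integral_pow_mul_exp_neg_pow_six, Nat.cast_mul, Nat.cast_ofNat]

theorem exp_mul_exp_neg_pi_div_six :
    Complex.exp ((Real.pi / 6 : ℝ) * Complex.I) * Complex.exp (-(Real.pi / 6 : ℝ) * Complex.I)
      = 1 := by
  rw [← Complex.exp_add]
  simp

theorem exp_add_exp_neg_pi_div_six :
    Complex.exp ((Real.pi / 6 : ℝ) * Complex.I) + Complex.exp (-(Real.pi / 6 : ℝ) * Complex.I)
      = (√3 : ℝ) := by
  rw [← Complex.two_cos, ← Complex.ofReal_cos, Real.cos_pi_div_six]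
  push_cast
  ring

theorem neg_exp_neg_pi_div_six_pow_three :
    (-Complex.exp (-(Real.pi / 6 : ℝ) * Complex.I)) ^ 3 = Complex.I := by
  have h := congrArg (· ^ 3) exp_mul_exp_neg_pi_div_six
  simp only [mul_pow, exp_pi_div_six_pow_three] at h
  linear_combination Complex.I * h - Complex.exp (-(Real.pi / 6 : ℝ) * Complex.I) ^ 3 * Complex.I_sq

theorem norm_neg_exp_neg_pi_div_six :
    ‖-Complex.exp (-(Real.pi / 6 : ℝ) * Complex.I)‖ = 1 := by
  rw [norm_neg, ← Complex.ofReal_neg, Complex.norm_exp_ofReal_mul_I]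

/-- Since `ω ^ 6 = -1` on both rays, the weights of the `n`-th terms depend, up to sign, only on `n`
modulo `3`; over the two rays they add up to `±√3`, `±√3` and `0`. -/
theorem rayIntegral_add_zero_right (b : ℂ) :
    Complex.exp (-(Real.pi / 6 : ℝ) * Complex.I) *
        rayIntegral b 0 (Complex.exp ((Real.pi / 6 : ℝ) * Complex.I)) +
      Complex.exp ((Real.pi / 6 : ℝ) * Complex.I) *
        rayIntegral b 0 (-Complex.exp (-(Real.pi / 6 : ℝ) * Complex.I)) =
    (√3 : ℝ) / 6 * (Complex.Gamma (1 / 6) *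
        hypergeometric2F2 (1 / 12) (7 / 12) (1 / 3) (2 / 3) (-4 * (Complex.I * b) ^ 3 / 27) +
      Complex.I * b * Complex.Gamma (5 / 6) *
        hypergeometric2F2 (5 / 12) (11 / 12) (2 / 3) (4 / 3)
          (-4 * (Complex.I * b) ^ 3 / 27)) := by
  have hω3 := exp_pi_div_six_pow_three
  have hv3 := neg_exp_neg_pi_div_six_pow_three
  have hs := ((hasSum_rayIntegral_zero_right b hω3 (Complex.norm_exp_ofReal_mul_I _)).mul_left
    (Complex.exp (-(Real.pi / 6 : ℝ) * Complex.I))).add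
    ((hasSum_rayIntegral_zero_right b hv3 norm_neg_exp_neg_pi_div_six).mul_left
    (Complex.exp ((Real.pi / 6 : ℝ) * Complex.I)))
  have hmul := exp_mul_exp_neg_pi_div_six
  have hadd := exp_add_exp_neg_pi_div_six
  generalize Complex.exp ((Real.pi / 6 : ℝ) * Complex.I) = ω at *
  generalize Complex.exp (-(Real.pi / 6 : ℝ) * Complex.I) = v at *
  have hω6 : (ω ^ 2) ^ 3 = -1 := by
    rw [← pow_mul, mul_comm, pow_mul, hω3, Complex.I_sq]
  have hv6 : ((-v) ^ 2) ^ 3 = -1 := by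
    rw [← pow_mul, mul_comm, pow_mul, hv3, Complex.I_sq]
  have hG1 := Gamma_two_mul_add (s := 1 / 6) (by norm_num)
  have hG5 := Gamma_two_mul_add (s := 5 / 6) (by norm_num)
  have hA : HasSum (fun k => (fun n : ℕ => v * ((Complex.I * b * ω ^ 2) ^ n / n.factorial *
      (Complex.Gamma ((4 * n + 1) / 6) / 6)) + ω * ((Complex.I * b * (-v) ^ 2) ^ n / n.factorial *
      (Complex.Gamma ((4 * n + 1) / 6) / 6))) (3 * k))
      ((√3 : ℝ) / 6 * Complex.Gamma (1 / 6) *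
        hypergeometric2F2 (1 / 12) (7 / 12) (1 / 3) (2 / 3) (-4 * (Complex.I * b) ^ 3 / 27)) := by
    refine ((hasSum_pow_div_factorial_three_mul _ _ _).mul_left _).congr_fun fun k => ?_
    have e1 : ((4 * ((3 * k : ℕ) : ℂ) + 1) / 6) = 2 * k + 1 / 6 := by push_cast; ring
    simp only
    rw [e1, hG1, pow_mul (_ * ω ^ 2), pow_mul (_ * (-v) ^ 2), mul_pow _ (ω ^ 2), hω6,
      mul_pow _ ((-v) ^ 2), hv6, ← hadd, show (-4 * (Complex.I * b) ^ 3 : ℂ) =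
        4 * ((Complex.I * b) ^ 3 * -1) by ring, mul_pow 4]
    norm_num
    ring
  have hB : HasSum (fun k => (fun n : ℕ => v * ((Complex.I * b * ω ^ 2) ^ n / n.factorial *
      (Complex.Gamma ((4 * n + 1) / 6) / 6)) + ω * ((Complex.I * b * (-v) ^ 2) ^ n / n.factorial *
      (Complex.Gamma ((4 * n + 1) / 6) / 6))) (3 * k + 1))
      ((√3 : ℝ) / 6 * (Complex.I * b * Complex.Gamma (5 / 6)) *
        hypergeometric2F2 (5 / 12) (11 / 12) (2 / 3) (4 / 3)
          (-4 * (Complex.I * b) ^ 3 / 27)) := by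
    refine ((hasSum_pow_div_factorial_three_mul_add_one _ _ _).mul_left _).congr_fun fun k => ?_
    have e1 : ((4 * ((3 * k + 1 : ℕ) : ℂ) + 1) / 6) = 2 * k + 5 / 6 := by push_cast; ring
    have e2 : v * ω ^ 2 + ω * (-v) ^ 2 = (√3 : ℝ) := by
      rw [← hadd]; linear_combination (ω + v) * hmul
    simp only
    rw [e1, hG5, pow_succ (_ * ω ^ 2), pow_succ (_ * (-v) ^ 2), pow_mul (_ * ω ^ 2),
      pow_mul (_ * (-v) ^ 2), mul_pow _ (ω ^ 2) 3, hω6,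
      mul_pow _ ((-v) ^ 2) 3, hv6, ← e2, show (-4 * (Complex.I * b) ^ 3 : ℂ) =
        4 * ((Complex.I * b) ^ 3 * -1) by ring, mul_pow 4]
    norm_num
    ring
  rw [hs.eq_add_of_mod_three hA hB fun k => ?_]
  · ring
  · have e2 : v * (ω ^ 2) ^ 2 + ω * ((-v) ^ 2) ^ 2 = 0 := by
      linear_combination (ω ^ 3 + v ^ 3) * hmul + hω3 - hv3
    rw [pow_add (_ * ω ^ 2), pow_add (_ * (-v) ^ 2), pow_mul (_ * ω ^ 2),
      pow_mul (_ * (-v) ^ 2), mul_pow _ (ω ^ 2) 3, hω6, mul_pow _ ((-v) ^ 2) 3, hv6,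
      mul_pow _ (ω ^ 2), mul_pow _ ((-v) ^ 2)]
    linear_combination ((Complex.I * b) ^ 3 * -1) ^ k * (Complex.I * b) ^ 2 /
      ((3 * k + 2).factorial : ℂ) *
      (Complex.Gamma ((4 * ((3 * k + 2 : ℕ) : ℂ) + 1) / 6) / 6) * e2

/-! ### The phase that is a perfect cube -/

/-- The function `exp (i s³)`. -/
noncomputable def expCube (s : ℂ) : ℂ := Complex.exp (Complex.I * s ^ 3)

theorem differentiable_expCube : Differentiable ℂ expCube := by
  unfold expCube
  fun_prop

theorem differentiable_iteratedDeriv_expCube (n : ℕ) :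
    Differentiable ℂ (iteratedDeriv n expCube) :=
  (differentiable_expCube.contDiff (n := n + 1)).differentiable_iteratedDeriv' n

theorem hasDerivAt_iteratedDeriv_expCube (n : ℕ) (t : ℂ) :
    HasDerivAt (iteratedDeriv n expCube) (iteratedDeriv (n + 1) expCube t) t := by
  rw [iteratedDeriv_succ]
  exact (differentiable_iteratedDeriv_expCube n t).hasDerivAt

theorem iteratedDeriv_one_expCube :
    iteratedDeriv 1 expCube = fun t => 3 * Complex.I * t ^ 2 * expCube t := by
  rw [iteratedDeriv_one]
  ext t
  have h : HasDerivAt expCube (Complex.exp (Complex.I * t ^ 3) * (Complex.I * (3 * t ^ 2))) t :=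
    (((hasDerivAt_pow 3 t).const_mul Complex.I).cexp).congr_deriv (by norm_num)
  rw [h.deriv, expCube]
  ring

theorem iteratedDeriv_two_expCube :
    iteratedDeriv 2 expCube = fun t => (6 * Complex.I * t - 9 * t ^ 4) * expCube t := by
  ext t
  refine (hasDerivAt_iteratedDeriv_expCube 1 t).unique ?_
  have h0 := hasDerivAt_iteratedDeriv_expCube 0 t
  rw [iteratedDeriv_zero] at h0
  rw [iteratedDeriv_one_expCube]
  refine (((hasDerivAt_pow 2 t).const_mul (3 * Complex.I)).mul h0).congr_deriv ?_
  rw [zero_add, iteratedDeriv_one_expCube]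
  push_cast
  linear_combination (9 * t ^ 4 * expCube t) * Complex.I_sq

/-- The equation `f' = 3 i t² f`, differentiated `n + 2` times. -/
theorem iteratedDeriv_expCube_add_three (n : ℕ) (t : ℂ) :
    iteratedDeriv (n + 3) expCube t = 3 * Complex.I * (t ^ 2 * iteratedDeriv (n + 2) expCube t +
      2 * (n + 2) * (t * iteratedDeriv (n + 1) expCube t) +
      (n + 2) * (n + 1) * iteratedDeriv n expCube t) := by
  induction n generalizing t with
  | zero =>
    refine (hasDerivAt_iteratedDeriv_expCube 2 t).unique ?_
    have h0 := hasDerivAt_iteratedDeriv_expCube 0 t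
    rw [iteratedDeriv_zero] at h0
    rw [iteratedDeriv_two_expCube]
    refine ((((hasDerivAt_id t).const_mul (6 * Complex.I)).sub
      ((hasDerivAt_pow 4 t).const_mul 9)).mul h0).congr_deriv ?_
    simp only [zero_add, iteratedDeriv_one_expCube, iteratedDeriv_zero,
      Pi.sub_apply, id]
    push_cast
    linear_combination (-36 * t ^ 3 * expCube t) * Complex.I_sq
  | succ n ih =>
    refine (hasDerivAt_iteratedDeriv_expCube (n + 3) t).unique ?_
    refine HasDerivAt.congr_of_eventuallyEq ?_ (Eventually.of_forall ih)
    refine ((((hasDerivAt_pow 2 t).mul (hasDerivAt_iteratedDeriv_expCube (n + 2) t)).add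
      (((hasDerivAt_id t).mul (hasDerivAt_iteratedDeriv_expCube (n + 1) t)).const_mul
        (2 * ((n : ℂ) + 2)))).add ((hasDerivAt_iteratedDeriv_expCube n t).const_mul
        (((n : ℂ) + 2) * (n + 1)))).const_mul (3 * Complex.I) |>.congr_deriv ?_
    simp only [id, show n + 1 + 2 = n + 3 by ring, show n + 1 + 1 = n + 2 by ring]
    push_cast
    ring

theorem expCube_sub (a t : ℂ) : expCube (t - a) =
    Complex.exp (-Complex.I * a ^ 3) *
      Complex.exp (Complex.I * cubicPhase (-3 * a) (3 * a ^ 2) t) := by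
  rw [← Complex.exp_add, expCube, cubicPhase]
  congr 1
  ring

/-- The factor of the Gaussian that dominates `expCube (ω * r ^ 2 - a)` for `‖a‖ ≤ ρ`. -/
noncomputable def expCubeBound (ρ : ℝ) : ℝ := Real.exp (ρ ^ 3 + (3 * ρ + 3 * ρ ^ 2 + 1) ^ 3)

theorem norm_expCube_sub_le {ω a : ℂ} (h3 : ω ^ 3 = Complex.I) (h1 : ‖ω‖ = 1) {ρ : ℝ}
    (ha : ‖a‖ ≤ ρ) (r : ℝ) :
    ‖expCube (ω * (r : ℂ) ^ 2 - a)‖ ≤ expCubeBound ρ * Real.exp (-r ^ 2) := by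
  rw [expCube_sub, norm_mul, expCubeBound, Real.exp_add, mul_assoc]
  have e1 : ‖Complex.exp (-Complex.I * a ^ 3)‖ ≤ Real.exp (ρ ^ 3) := by
    refine (Complex.norm_exp_le_exp_norm _).trans (Real.exp_le_exp.2 ?_)
    rw [norm_mul, norm_neg, Complex.norm_I, one_mul, norm_pow]
    gcongr
  refine mul_le_mul e1 ((norm_exp_I_mul_cubicPhase_le_gaussian _ _ h3 h1 r).trans ?_)
    (norm_nonneg _) (Real.exp_pos _).le
  have e2 : ‖-3 * a‖ = 3 * ‖a‖ := by simp
  have e3 : ‖3 * a ^ 2‖ = 3 * ‖a‖ ^ 2 := by simp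
  rw [e2, e3]
  gcongr

/-- Cauchy's estimate on the circle of radius `ρ`. -/
theorem norm_iteratedDeriv_expCube_le {ω : ℂ} (h3 : ω ^ 3 = Complex.I) (h1 : ‖ω‖ = 1)
    {ρ : ℝ} (hρ : 0 < ρ) (n : ℕ) (r : ℝ) :
    ‖iteratedDeriv n expCube (ω * (r : ℂ) ^ 2)‖ ≤
      n.factorial * (expCubeBound ρ * Real.exp (-r ^ 2)) / ρ ^ n := by
  refine Complex.norm_iteratedDeriv_le_of_forall_mem_sphere_norm_le n hρ
    differentiable_expCube.diffContOnCl fun w hw => ?_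
  have := norm_expCube_sub_le h3 h1 (a := ω * (r : ℂ) ^ 2 - w) (ρ := ρ)
    (by rw [norm_sub_rev, ← dist_eq_norm]; exact (Metric.mem_sphere.1 hw).le) r
  rwa [sub_sub_cancel] at this

/-- The `m`-th moment, in `r`, of the `n`-th derivative of `exp (i s³)` on the ray `s = ω r²`. -/
noncomputable def derivMoment (ω : ℂ) (m n : ℕ) : ℂ :=
  ∫ r in Set.Ioi (0 : ℝ), (r : ℂ) ^ m * iteratedDeriv n expCube (ω * (r : ℂ) ^ 2)

theorem continuous_iteratedDeriv_expCube_ray (ω : ℂ) (n : ℕ) :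
    Continuous fun r : ℝ => iteratedDeriv n expCube (ω * (r : ℂ) ^ 2) :=
  (differentiable_iteratedDeriv_expCube n).continuous.comp (by fun_prop)

theorem norm_pow_mul_iteratedDeriv_expCube_le {ω : ℂ} (h3 : ω ^ 3 = Complex.I) (h1 : ‖ω‖ = 1)
    (m n : ℕ) {r : ℝ} (hr : 0 ≤ r) :
    ‖(r : ℂ) ^ m * iteratedDeriv n expCube (ω * (r : ℂ) ^ 2)‖ ≤
      n.factorial * expCubeBound 1 * (r ^ m * Real.exp (-r ^ 2)) := by
  have h := norm_iteratedDeriv_expCube_le h3 h1 one_pos n r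
  rw [one_pow, div_one] at h
  rw [norm_mul, norm_pow, Complex.norm_real, Real.norm_of_nonneg hr]
  calc _ ≤ r ^ m * (n.factorial * (expCubeBound 1 * Real.exp (-r ^ 2))) := by gcongr
    _ = _ := by ring

theorem integrableOn_derivMoment {ω : ℂ} (h3 : ω ^ 3 = Complex.I) (h1 : ‖ω‖ = 1) (m n : ℕ) :
    IntegrableOn (fun r : ℝ => (r : ℂ) ^ m * iteratedDeriv n expCube (ω * (r : ℂ) ^ 2))
      (Set.Ioi 0) := by
  have hi := integrableOn_rpow_mul_exp_neg_mul_sq one_pos (s := m)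
    (by have : (0 : ℝ) ≤ m := Nat.cast_nonneg m
        linarith)
  simp only [Real.rpow_natCast, neg_mul, one_mul] at hi
  refine (hi.const_mul (n.factorial * expCubeBound 1)).mono' ?_ ?_
  · have := continuous_iteratedDeriv_expCube_ray ω n
    exact Continuous.aestronglyMeasurable (by fun_prop)
  · exact (ae_restrict_mem measurableSet_Ioi).mono fun r hr =>
      norm_pow_mul_iteratedDeriv_expCube_le h3 h1 m n (le_of_lt hr)

theorem tendsto_pow_mul_iteratedDeriv_expCube {ω : ℂ} (h3 : ω ^ 3 = Complex.I) (h1 : ‖ω‖ = 1)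
    (m n : ℕ) :
    Tendsto (fun r : ℝ => (r : ℂ) ^ m * iteratedDeriv n expCube (ω * (r : ℂ) ^ 2))
      atTop (𝓝 0) := by
  have h := (Real.tendsto_pow_mul_exp_neg_atTop_nhds_zero m).const_mul
    (n.factorial * expCubeBound 1)
  rw [mul_zero] at h
  refine squeeze_zero_norm' ?_ h
  filter_upwards [eventually_ge_atTop 1] with r hr
  refine (norm_pow_mul_iteratedDeriv_expCube_le h3 h1 m n (by linarith)).trans ?_
  have : 0 ≤ expCubeBound 1 := (Real.exp_pos _).le
  gcongr
  nlinarith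

/-- Integration by parts of `r ^ (m + 1)` times the `n`-th derivative. -/
theorem derivMoment_add_two_succ {ω : ℂ} (h3 : ω ^ 3 = Complex.I) (h1 : ‖ω‖ = 1) (m n : ℕ) :
    2 * ω * derivMoment ω (m + 2) (n + 1) = -(m + 1) * derivMoment ω m n := by
  have hd : ∀ r ∈ Set.Ici (0 : ℝ), HasDerivAt
      (fun r : ℝ => (r : ℂ) ^ (m + 1) * iteratedDeriv n expCube (ω * (r : ℂ) ^ 2))
      ((m + 1) * ((r : ℂ) ^ m * iteratedDeriv n expCube (ω * (r : ℂ) ^ 2)) + 2 * ω *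
        ((r : ℂ) ^ (m + 2) * iteratedDeriv (n + 1) expCube (ω * (r : ℂ) ^ 2))) r := by
    intro r _
    have hr : HasDerivAt (fun r : ℝ => (r : ℂ)) 1 r := (hasDerivAt_id r).ofReal_comp
    have hp : ∀ k : ℕ, HasDerivAt (fun r : ℝ => (r : ℂ) ^ k) (k * (r : ℂ) ^ (k - 1) * 1) r :=
      fun k => hr.pow k
    have h := (hasDerivAt_iteratedDeriv_expCube n (ω * (r : ℂ) ^ 2)).comp r ((hp 2).const_mul ω)
    simp only [Function.comp_def] at h
    refine ((hp (m + 1)).mul h).congr_deriv ?_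
    simp only [Nat.add_sub_cancel]
    push_cast
    ring
  have i1 := (integrableOn_derivMoment h3 h1 m n).const_mul ((m : ℂ) + 1)
  have i2 := (integrableOn_derivMoment h3 h1 (m + 2) (n + 1)).const_mul (2 * ω)
  have h := integral_Ioi_of_hasDerivAt_of_tendsto' hd (i1.add i2)
    (tendsto_pow_mul_iteratedDeriv_expCube h3 h1 (m + 1) n)
  rw [integral_add i1 i2, integral_const_mul, integral_const_mul] at h
  simp only [Complex.ofReal_zero, zero_pow (Nat.succ_ne_zero m), zero_mul, sub_zero] at h
  unfold derivMoment
  linear_combination h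

/-- The differential equation expresses the left side by moments of orders `4`, `2` and `0`;
integration by parts reduces these to the last one. -/
theorem derivMoment_add_three {ω : ℂ} (h3 : ω ^ 3 = Complex.I) (h1 : ‖ω‖ = 1) (n : ℕ) :
    derivMoment ω 0 (n + 3) =
      3 * Complex.I * ((n + 1 / 2) * (n + 3 / 2)) * derivMoment ω 0 n := by
  have e : derivMoment ω 0 (n + 3) = 3 * Complex.I * (ω ^ 2 * derivMoment ω 4 (n + 2) +
      2 * (n + 2) * (ω * derivMoment ω 2 (n + 1)) + (n + 2) * (n + 1) * derivMoment ω 0 n) := by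
    have i4 := (integrableOn_derivMoment h3 h1 4 (n + 2)).const_mul (ω ^ 2)
    have i2 := (integrableOn_derivMoment h3 h1 2 (n + 1)).const_mul (2 * ((n : ℂ) + 2) * ω)
    have i0 := (integrableOn_derivMoment h3 h1 0 n).const_mul (((n : ℂ) + 2) * (n + 1))
    have s := integral_add (i4.add i2) i0
    simp only [Pi.add_apply] at s
    rw [integral_add i4 i2, integral_const_mul, integral_const_mul, integral_const_mul] at s
    rw [← mul_assoc (2 * ((n : ℂ) + 2))]
    unfold derivMoment
    rw [← s, ← integral_const_mul]
    congr 1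
    ext r
    rw [iteratedDeriv_expCube_add_three]
    ring
  have a := derivMoment_add_two_succ h3 h1 0 n
  have b := derivMoment_add_two_succ h3 h1 2 (n + 1)
  push_cast at b a
  rw [e]
  linear_combination (3 * Complex.I * (ω / 2)) * b +
    (3 * Complex.I * ((n + 2) - 3 / 4)) * a

theorem expCube_ray {ω : ℂ} (h3 : ω ^ 3 = Complex.I) (r : ℝ) :
    expCube (ω * (r : ℂ) ^ 2) = Complex.exp (-(r : ℂ) ^ 6) := by
  unfold expCube
  congr 1
  linear_combination (Complex.I * (r : ℂ) ^ 6) * h3 + (r : ℂ) ^ 6 * Complex.I_sq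

theorem derivMoment_zero_right {ω : ℂ} (h3 : ω ^ 3 = Complex.I) (m : ℕ) :
    derivMoment ω m 0 = Complex.Gamma ((m + 1) / 6) / 6 := by
  unfold derivMoment
  rw [← integral_pow_mul_exp_neg_pow_six]
  simp only [iteratedDeriv_zero, expCube_ray h3]

theorem derivMoment_one {ω : ℂ} (h3 : ω ^ 3 = Complex.I) :
    derivMoment ω 0 1 = 3 * Complex.I * ω ^ 2 * (Complex.Gamma (5 / 6) / 6) := by
  have h : derivMoment ω 0 1 = 3 * Complex.I * ω ^ 2 * derivMoment ω 4 0 := by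
    unfold derivMoment
    rw [← integral_const_mul]
    congr 1
    ext r
    rw [iteratedDeriv_one_expCube, iteratedDeriv_zero]
    ring
  rw [h, derivMoment_zero_right h3]
  norm_num

/-- The moment is a multiple of `ω` with a factor independent of the ray, so it cancels in the
combination of the two rays. -/
theorem derivMoment_two {ω : ℂ} (h3 : ω ^ 3 = Complex.I) (h1 : ‖ω‖ = 1) :
    derivMoment ω 0 2 =
      ω * (Complex.I * (Complex.Gamma (1 / 2) - 3 / 2 * Complex.Gamma (3 / 2))) := by
  have h : derivMoment ω 0 2 =
      6 * Complex.I * ω * derivMoment ω 2 0 - 9 * Complex.I * ω * derivMoment ω 8 0 := by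
    unfold derivMoment
    rw [← integral_const_mul, ← integral_const_mul, ← integral_sub
      ((integrableOn_derivMoment h3 h1 2 0).const_mul _)
      ((integrableOn_derivMoment h3 h1 8 0).const_mul _)]
    congr 1
    ext r
    rw [iteratedDeriv_two_expCube, iteratedDeriv_zero]
    linear_combination (-9 * ω * (r : ℂ) ^ 8 * expCube (ω * (r : ℂ) ^ 2)) * h3
  rw [h, derivMoment_zero_right h3, derivMoment_zero_right h3]
  norm_num
  ring

/-- Taylor expansion of `exp (i (t - a)³)` in `a`, integrated term by term. -/
theorem hasSum_rayIntegral_cube {ω : ℂ} (h3 : ω ^ 3 = Complex.I) (h1 : ‖ω‖ = 1) (a : ℂ) :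
    HasSum (fun n : ℕ => (-a) ^ n / n.factorial * derivMoment ω 0 n)
      (Complex.exp (-Complex.I * a ^ 3) * rayIntegral (-3 * a) (3 * a ^ 2) ω) := by
  -- Any radius larger than `‖a‖` makes the dominating series geometric with ratio less than `1`.
  set ρ : ℝ := 2 * ‖a‖ + 1 with hρ_def
  have hρ : 0 < ρ := by positivity
  set q : ℝ := ‖a‖ / ρ with hq_def
  have hq0 : 0 ≤ q := by positivity
  have hq1 : q < 1 := by
    rw [hq_def, div_lt_one hρ]
    linarith [norm_nonneg a]
  have hgeo : ∀ r : ℝ, HasSum (fun n : ℕ => expCubeBound ρ * Real.exp (-r ^ 2) * q ^ n)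
      (expCubeBound ρ * Real.exp (-r ^ 2) * (1 - q)⁻¹) := fun r =>
    (hasSum_geometric_of_lt_one hq0 hq1).mul_left _
  have key : HasSum (fun n : ℕ => ∫ r in Set.Ioi (0 : ℝ), (-a) ^ n / n.factorial *
      ((r : ℂ) ^ 0 * iteratedDeriv n expCube (ω * (r : ℂ) ^ 2)))
      (∫ r in Set.Ioi (0 : ℝ), expCube (ω * (r : ℂ) ^ 2 - a)) := by
    refine hasSum_integral_of_dominated_convergence
      (fun n r => expCubeBound ρ * Real.exp (-r ^ 2) * q ^ n)
      (fun n => ?_) (fun n => ae_of_all _ fun r => ?_)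
      (ae_of_all _ fun r => (hgeo r).summable) ?_ (ae_of_all _ fun r => ?_)
    · have := continuous_iteratedDeriv_expCube_ray ω n
      exact Continuous.aestronglyMeasurable (by fun_prop)
    · have h := norm_iteratedDeriv_expCube_le h3 h1 hρ n r
      have hn : (0 : ℝ) < n.factorial := by exact_mod_cast n.factorial_pos
      rw [pow_zero, one_mul, norm_mul, norm_div, norm_pow, norm_neg, Complex.norm_natCast]
      calc _ ≤ ‖a‖ ^ n / n.factorial *
            (n.factorial * (expCubeBound ρ * Real.exp (-r ^ 2)) / ρ ^ n) := by gcongr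
        _ = _ := by
          rw [hq_def, div_pow]
          field_simp
    · simp only [fun r => (hgeo r).tsum_eq]
      exact (integrableOn_exp_neg_sq.const_mul _).mul_const _
    · have h := Complex.hasSum_taylorSeries_of_entire differentiable_expCube
        (ω * (r : ℂ) ^ 2) (ω * (r : ℂ) ^ 2 - a)
      refine h.congr_fun fun n => ?_
      rw [sub_sub_cancel_left, smul_eq_mul, smul_eq_mul]
      ring
  simp only [expCube_sub, integral_const_mul] at key
  exact key

theorem rayIntegral_add_cube (a : ℂ) :
    Complex.exp (-Complex.I * a ^ 3) * (Complex.exp (-(Real.pi / 6 : ℝ) * Complex.I) *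
        rayIntegral (-3 * a) (3 * a ^ 2) (Complex.exp ((Real.pi / 6 : ℝ) * Complex.I)) +
      Complex.exp ((Real.pi / 6 : ℝ) * Complex.I) *
        rayIntegral (-3 * a) (3 * a ^ 2) (-Complex.exp (-(Real.pi / 6 : ℝ) * Complex.I))) =
    (√3 : ℝ) / 6 * (Complex.Gamma (1 / 6) *
        hypergeometric2F2 (1 / 6) (1 / 2) (1 / 3) (2 / 3) (-Complex.I * a ^ 3) +
      Complex.I * (-3 * a) * Complex.Gamma (5 / 6) *
        hypergeometric2F2 (1 / 2) (5 / 6) (2 / 3) (4 / 3) (-Complex.I * a ^ 3)) := by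
  have hω3 := exp_pi_div_six_pow_three
  have hv3 := neg_exp_neg_pi_div_six_pow_three
  have hωn : ‖Complex.exp ((Real.pi / 6 : ℝ) * Complex.I)‖ = 1 :=
    Complex.norm_exp_ofReal_mul_I _
  have hvn := norm_neg_exp_neg_pi_div_six
  have hmul := exp_mul_exp_neg_pi_div_six
  have hadd := exp_add_exp_neg_pi_div_six
  generalize Complex.exp ((Real.pi / 6 : ℝ) * Complex.I) = ω at *
  generalize Complex.exp (-(Real.pi / 6 : ℝ) * Complex.I) = v at *
  obtain ⟨C, hC⟩ : ∃ C : ℕ → ℂ, ∀ n, C n = v * derivMoment ω 0 n + ω * derivMoment (-v) 0 n :=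
    ⟨_, fun _ => rfl⟩
  have hs : HasSum (fun n : ℕ => (-a) ^ n / n.factorial * C n)
      (Complex.exp (-Complex.I * a ^ 3) * (v * rayIntegral (-3 * a) (3 * a ^ 2) ω +
        ω * rayIntegral (-3 * a) (3 * a ^ 2) (-v))) := by
    have h := ((hasSum_rayIntegral_cube hω3 hωn a).mul_left v).add
      ((hasSum_rayIntegral_cube hv3 hvn a).mul_left ω)
    convert! h using 1
    · ext n; rw [hC]; ring
    · ring
  have hrec : ∀ n, C (n + 3) = 3 * Complex.I * ((n + 1 / 2) * (n + 3 / 2)) * C n := fun n => by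
    rw [hC, hC, derivMoment_add_three hω3 hωn, derivMoment_add_three hv3 hvn]
    ring
  have hC0 : C 0 = (√3 : ℝ) / 6 * Complex.Gamma (1 / 6) := by
    rw [hC, derivMoment_zero_right hω3, derivMoment_zero_right hv3, ← hadd]
    norm_num
    ring
  have hC1 : C 1 = (√3 : ℝ) / 6 * (3 * Complex.I * Complex.Gamma (5 / 6)) := by
    rw [hC, derivMoment_one hω3, derivMoment_one hv3, ← hadd]
    linear_combination (3 * Complex.I * (Complex.Gamma (5 / 6) / 6) * (ω + v)) * hmul
  have hC2 : C 2 = 0 := by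
    rw [hC, derivMoment_two hω3 hωn, derivMoment_two hv3 hvn]
    ring
  have hj : ∀ j : ℕ, ∀ k : ℕ, C (3 * k + j) = (27 * Complex.I) ^ k *
      ((ascPochhammer ℂ k).eval (((j : ℂ) + 1 / 2) / 3) *
        (ascPochhammer ℂ k).eval (((j : ℂ) + 3 / 2) / 3)) * C j := by
    intro j k
    induction k with
    | zero => simp
    | succ k ih =>
      rw [show 3 * (k + 1) + j = 3 * k + j + 3 by ring, hrec, ih, ascPochhammer_succ_eval,
        ascPochhammer_succ_eval, pow_succ]
      push_cast
      ring
  have hu : (-a) ^ 3 * (27 * Complex.I) / 27 = -Complex.I * a ^ 3 := by ring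
  have hA : HasSum (fun k => (fun n : ℕ => (-a) ^ n / n.factorial * C n) (3 * k))
      (C 0 * hypergeometric2F2 (1 / 6) (1 / 2) (1 / 3) (2 / 3) (-Complex.I * a ^ 3)) := by
    rw [← hu]
    refine ((hasSum_pow_div_factorial_three_mul _ _ _).mul_left _).congr_fun fun k => ?_
    have h := hj 0 k
    rw [add_zero] at h
    simp only
    rw [h, pow_mul, mul_pow ((-a) ^ 3) (27 * Complex.I)]
    norm_num
    ring
  have hB : HasSum (fun k => (fun n : ℕ => (-a) ^ n / n.factorial * C n) (3 * k + 1))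
      (-a * C 1 * hypergeometric2F2 (1 / 2) (5 / 6) (2 / 3) (4 / 3) (-Complex.I * a ^ 3)) := by
    rw [← hu]
    refine ((hasSum_pow_div_factorial_three_mul_add_one _ _ _).mul_left _).congr_fun fun k => ?_
    simp only
    rw [hj 1 k, pow_succ, pow_mul, mul_pow ((-a) ^ 3) (27 * Complex.I)]
    norm_num
    ring
  rw [hs.eq_add_of_mod_three hA hB fun k => by rw [hj 2 k, hC2]; simp, hC0, hC1]
  ring

/-! ### Values of the elliptic umbilic integral -/

theorem HasFourierTransformAt.fourierTransform2_eq {f : ℝ × ℝ → ℂ} {x y : ℝ} {w : ℂ}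
    (h : HasFourierTransformAt f x y w) : fourierTransform2 f x y = w :=
  Tendsto.limUnder_eq h

/-- The reflection formula `Γ(1/6) Γ(5/6) = 2 π` turns the Gamma factors of the series into those of
the closed form. -/
theorem gamma_constants_eq (z F₀ F₁ : ℂ) :
    (√(Real.pi / 3) : ℂ) / Real.pi * ((√3 : ℝ) / 6 * (Complex.Gamma (1 / 6) * F₀ +
      Complex.I * (-2 * z) * Complex.Gamma (5 / 6) * F₁)) =
    (√Real.pi : ℂ) / 3 * (1 / Complex.Gamma (5 / 6) * F₀ -
      Complex.I * z / (3 * Complex.Gamma (7 / 6)) * F₁) := by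
  have hπ : (Real.pi : ℂ) ≠ 0 := Complex.ofReal_ne_zero.2 Real.pi_ne_zero
  have hs : (√(Real.pi / 3) : ℂ) * (√3 : ℝ) = √Real.pi := by
    rw [← Complex.ofReal_mul, ← Real.sqrt_mul (by positivity)]
    norm_num
  have hr : Complex.Gamma (1 / 6) * Complex.Gamma (5 / 6) = 2 * Real.pi := by
    have h := Complex.Gamma_mul_Gamma_one_sub (1 / 6)
    have e : (Real.pi : ℂ) * (1 / 6) = ((Real.pi / 6 : ℝ) : ℂ) := by push_cast; ring
    rw [e, ← Complex.ofReal_sin, Real.sin_pi_div_six] at h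
    rw [show (5 / 6 : ℂ) = 1 - 1 / 6 by norm_num, h]
    push_cast
    field_simp
  have h7 : Complex.Gamma (7 / 6) = Complex.Gamma (1 / 6) / 6 := by
    rw [show (7 / 6 : ℂ) = 1 / 6 + 1 by norm_num, Complex.Gamma_add_one _ (by norm_num)]
    ring
  have h1 : Complex.Gamma (1 / 6) ≠ 0 := fun h => by
    rw [h, zero_mul] at hr
    exact mul_ne_zero two_ne_zero hπ hr.symm
  have h5 : Complex.Gamma (5 / 6) ≠ 0 := fun h => by
    rw [h, mul_zero] at hr
    exact mul_ne_zero two_ne_zero hπ hr.symm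
  have i5 : 1 / Complex.Gamma (5 / 6) = Complex.Gamma (1 / 6) / (2 * Real.pi) := by
    rw [← hr]; field_simp
  have i7 : Complex.I * z / (3 * Complex.Gamma (7 / 6)) =
      Complex.I * z * Complex.Gamma (5 / 6) / Real.pi := by
    rw [h7, div_eq_div_iff (mul_ne_zero three_ne_zero (div_ne_zero h1 (by norm_num))) hπ]
    linear_combination (-(Complex.I * z) / 2) * hr
  rw [i5, i7, ← hs]
  field_simp
  ring

theorem hasFourierTransformAt_umbilicDistribution_sq (z : ℝ) :
    HasFourierTransformAt (umbilicDistribution z) (z ^ 2) 0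
      ((Real.sqrt Real.pi : ℂ) / 3 * Complex.exp (5 * Complex.I * (z : ℂ) ^ 3 / 27) *
          (1 / Complex.Gamma (5 / 6) *
              hypergeometric2F2 (1 / 12) (7 / 12) (1 / 3) (2 / 3)
                (-(32 / 27) * Complex.I * (z : ℂ) ^ 3)
            - Complex.I * z / (3 * Complex.Gamma (7 / 6)) *
              hypergeometric2F2 (5 / 12) (11 / 12) (2 / 3) (4 / 3)
                (-(32 / 27) * Complex.I * (z : ℂ) ^ 3))) := by
  have h := hasFourierTransformAt_umbilicDistribution (z ^ 2) z
  rw [sub_self, Complex.ofReal_zero, rayIntegral_add_zero_right] at h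
  have hw : -4 * (Complex.I * ((-2 * z : ℝ) : ℂ)) ^ 3 / 27 =
      -(32 / 27) * Complex.I * (z : ℂ) ^ 3 := by
    push_cast
    linear_combination (32 / 27 * Complex.I * (z : ℂ) ^ 3) * Complex.I_sq
  have hκ : ((z ^ 2 * z / 3 - 4 * z ^ 3 / 27 : ℝ) : ℂ) * Complex.I =
      5 * Complex.I * (z : ℂ) ^ 3 / 27 := by push_cast; ring
  rw [hw, hκ] at h
  convert h using 1
  rw [mul_right_comm, ← gamma_constants_eq]
  push_cast
  ring

theorem hasFourierTransformAt_umbilicDistribution_neg_sq_div_three (z : ℝ) :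
    HasFourierTransformAt (umbilicDistribution z) (-(z ^ 2 / 3)) 0
      ((Real.sqrt Real.pi : ℂ) / 3 * Complex.exp (Complex.I * (z : ℂ) ^ 3 / 27) *
          (1 / Complex.Gamma (5 / 6) *
              hypergeometric2F2 (1 / 6) (1 / 2) (1 / 3) (2 / 3)
                (-(8 / 27) * Complex.I * (z : ℂ) ^ 3)
            - Complex.I * z / (3 * Complex.Gamma (7 / 6)) *
              hypergeometric2F2 (1 / 2) (5 / 6) (2 / 3) (4 / 3)
                (-(8 / 27) * Complex.I * (z : ℂ) ^ 3))) := by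
  have h := hasFourierTransformAt_umbilicDistribution (-(z ^ 2 / 3)) z
  have k := rayIntegral_add_cube (2 * z / 3)
  have hb : ((-2 * z : ℝ) : ℂ) = -3 * (2 * z / 3) := by push_cast; ring
  have hc : ((z ^ 2 - -(z ^ 2 / 3) : ℝ) : ℂ) = 3 * (2 * (z : ℂ) / 3) ^ 2 := by push_cast; ring
  have hw : -Complex.I * (2 * (z : ℂ) / 3) ^ 3 = -(8 / 27) * Complex.I * (z : ℂ) ^ 3 := by ring
  have hκ : Complex.exp (((-(z ^ 2 / 3) * z / 3 - 4 * z ^ 3 / 27 : ℝ) : ℂ) * Complex.I) =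
      Complex.exp (Complex.I * (z : ℂ) ^ 3 / 27) *
        Complex.exp (-(8 / 27) * Complex.I * (z : ℂ) ^ 3) := by
    rw [← Complex.exp_add]
    congr 1
    push_cast
    ring
  rw [hw] at k
  rw [hb, hc, hκ] at h
  convert h using 1
  rw [mul_right_comm, ← gamma_constants_eq]
  linear_combination (-(√(Real.pi / 3) : ℂ) / Real.pi *
    Complex.exp (Complex.I * (z : ℂ) ^ 3 / 27)) * k

theorem mainTheorem3 (z : ℝ) :
    (HasFourierTransformAt (umbilicDistribution z) (z ^ 2) 0 (ellipticUmbilic (z ^ 2) 0 z) ∧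
      ellipticUmbilic (z ^ 2) 0 z =
        (Real.sqrt Real.pi : ℂ) / 3 * Complex.exp (5 * Complex.I * (z : ℂ) ^ 3 / 27) *
          (1 / Complex.Gamma (5 / 6) *
              hypergeometric2F2 (1 / 12) (7 / 12) (1 / 3) (2 / 3)
                (-(32 / 27) * Complex.I * (z : ℂ) ^ 3)
            - Complex.I * z / (3 * Complex.Gamma (7 / 6)) *
              hypergeometric2F2 (5 / 12) (11 / 12) (2 / 3) (4 / 3)
                (-(32 / 27) * Complex.I * (z : ℂ) ^ 3))) ∧
    (HasFourierTransformAt (umbilicDistribution z) (-(z ^ 2 / 3)) 0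
        (ellipticUmbilic (-(z ^ 2 / 3)) 0 z) ∧
      ellipticUmbilic (-(z ^ 2 / 3)) 0 z =
        (Real.sqrt Real.pi : ℂ) / 3 * Complex.exp (Complex.I * (z : ℂ) ^ 3 / 27) *
          (1 / Complex.Gamma (5 / 6) *
              hypergeometric2F2 (1 / 6) (1 / 2) (1 / 3) (2 / 3)
                (-(8 / 27) * Complex.I * (z : ℂ) ^ 3)
            - Complex.I * z / (3 * Complex.Gamma (7 / 6)) *
              hypergeometric2F2 (1 / 2) (5 / 6) (2 / 3) (4 / 3)
                (-(8 / 27) * Complex.I * (z : ℂ) ^ 3))) := by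
  have h₁ := hasFourierTransformAt_umbilicDistribution_sq z
  have h₂ := hasFourierTransformAt_umbilicDistribution_neg_sq_div_three z
  have e₁ : ellipticUmbilic (z ^ 2) 0 z = _ := h₁.fourierTransform2_eq
  have e₂ : ellipticUmbilic (-(z ^ 2 / 3)) 0 z = _ := h₂.fourierTransform2_eq
  exact ⟨⟨e₁ ▸ h₁, e₁⟩, ⟨e₂ ▸ h₂, e₂⟩⟩
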